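/- Let $\mathbb{H}^+=\{x+\mathrm{i}y : x\ge 0,\ y\in\mathbb{R}\}$, viewed as a closed half-plane in $\mathbb{R}^3$ bounded by the $y$-axis, let $\mathbf{R}_\phi$ be the rotation of $\mathbb{R}^3$ by the angle $\phi$ about the $y$-axis, and for $A\subset\mathbb{H}^+$ let $\Gamma(A)=\{\mathbf{R}_\phi x : x\in A,\ 0\le\phi<2\pi\}$. For $s>0$ and $z,w\in\mathbb{H}^+$ put $$\mathcal{K}_s(z,w)=\frac1{2\pi}\int_0^{2\pi}\frac{d\phi}{|\mathbf{R}_\phi z-w|^s}\in(0,+\infty],$$ and for $s\ne 1$ and $R>0$ put $$\mathcal{K}_s^{(R)}(z,w)=\begin{cases}2R\,\bigl[\mathcal{K}_s(R+z,R+w)-\mathcal{I}_s\,R^{-s}\bigr], & 0<s<1,\\ 2R\,\mathcal{K}_s(R+z,R+w), & s>1,\end{cases}\qquad \mathcal{K}_s^{(\infty)}(z,w)=\frac{\Gamma((s-1)/2)}{\sqrt\pi\,\Gamma(s/2)}\,|z-w|^{1-s},$$ where $\mathcal{I}_s=\frac{1}{(2\pi)^2}\int_0^{2\pi}\!\int_0^{2\pi}|e^{\mathrm{i}\phi}-e^{\mathrm{i}\psi}|^{-s}\,d\phi\,d\psi$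 is the Riesz $s$-energy of the normalized arc-length measure on the unit circle, $\Gamma(\cdot)$ in the last formula is the gamma function, and $\mathcal{K}_s^{(\infty)}(z,z)=+\infty$ if $s>1$. Let $A$ be an infinite compact subset of the interior of $\mathbb{H}^+$ and let $0<s<\dim\Gamma(A)$ (Hausdorff dimension). Let $\mathcal{K}$ be $\mathcal{K}_s$, or, if $s\neq1$, one of $\mathcal{K}_s^{(R)}$ (with $R>0$) and $\mathcal{K}_s^{(\infty)}$. For an $N$-tuple $Z=(z_1,\dots,z_N)$ of (not necessarily distinct) points of $A$ let $E_{\mathcal{K}}(Z)=\sum_{j\ne k}\mathcal{K}(z_j,z_k)$, and let $\mathcal{E}_{\mathcal{K}}(A,N)$ be the infimum of $E_{\mathcal{K}}(Z)$ over all such $N$-tuples. For a Borel probability measure $\lambda$ on $A$ let $\mathcal{J}_{\mathcal{K}}[\lambda]=\iint\mathcal{K}(z,w)\,d\lambda(z)\,d\lambda(w)$. Then there is a unique Borel probability measure $\lambda_{\mathcal{K},A}$ on $A$ (the equilibrium measure) that minimizes $\mathcal{J}_{\mathcal{K}}$ over all Borel probability measures on $A$, and its energy is finite. For every $N\ge2$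 the infimum $\mathcal{E}_{\mathcal{K}}(A,N)$ is attained, and if for every $N\ge2$ the tuple $Z_N^*=(z_{1,N}^*,\dots,z_{N,N}^*)$ is a minimizer, then $$\frac1N\sum_{k=1}^N\delta_{z_{k,N}^*}\longrightarrow\lambda_{\mathcal{K},A}\quad\text{weak-star as }N\to\infty .$$ Moreover $$\lim_{N\to\infty}\frac{\mathcal{E}_{\mathcal{K}}(A,N)}{N^2}=\mathcal{J}_{\mathcal{K}}[\lambda_{\mathcal{K},A}].$$ -/

import Mathlib

open MeasureTheory Filter Topology
open scoped ENNReal NNReal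

noncomputable section

namespace RevolutionEnergy

/-- The closed right half-plane `ℍ⁺ = {x + i y | x ≥ 0}`. -/
def rightHalfPlane : Set ℂ := {z : ℂ | 0 ≤ z.re}

/-- The reference plane inside `ℝ³`: the point `x + i y` is identified with `(x, y, 0)`, so that
the imaginary axis becomes the `y`-axis (the axis of revolution). -/
def embed (z : ℂ) : EuclideanSpace ℝ (Fin 3) := !₂[z.re, z.im, 0]

/-- The rotation `R_φ` of `ℝ³` by the angle `φ` about the `y`-axis. -/
def rot (φ : ℝ) (p : EuclideanSpace ℝ (Fin 3)) : EuclideanSpace ℝ (Fin 3) :=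
  !₂[Real.cos φ * p 0 + Real.sin φ * p 2, p 1, -Real.sin φ * p 0 + Real.cos φ * p 2]

/-- The set of revolution `Γ(A) = {R_φ x | x ∈ A, 0 ≤ φ < 2π}` in Euclidean `ℝ³`. -/
def revolve (A : Set ℂ) : Set (EuclideanSpace ℝ (Fin 3)) :=
  {p | ∃ z ∈ A, ∃ φ ∈ Set.Ico (0 : ℝ) (2 * Real.pi), p = rot φ (embed z)}

/-- The kernel `𝒦_s(z, w) = (1 / 2π) ∫_0^{2π} |R_φ z - w|^{-s} dφ`, with values in `[0, ∞]`
(the value is `∞` when the integral diverges). -/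
def kernelS (s : ℝ) (z w : ℂ) : ℝ≥0∞ :=
  (∫⁻ φ in Set.Ico (0 : ℝ) (2 * Real.pi), (edist (rot φ (embed z)) (embed w)) ^ (-s))
    / ENNReal.ofReal (2 * Real.pi)

/-- The Riesz `s`-energy `𝓘_s(𝕊¹; dφ / 2π)` of the normalized arc-length measure on the unit
circle; it is finite for `0 < s < 1`, the only range in which it is used. -/
def circleEnergy (s : ℝ) : ℝ :=
  ((∫⁻ φ in Set.Ico (0 : ℝ) (2 * Real.pi), ∫⁻ ψ in Set.Ico (0 : ℝ) (2 * Real.pi),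
      (edist (Complex.exp (φ * Complex.I)) (Complex.exp (ψ * Complex.I))) ^ (-s))
    / ENNReal.ofReal (2 * Real.pi) ^ 2).toReal

/-- The kernel `𝒦_s^{(R)}`: it is `2R [𝒦_s(R + z, R + w) - 𝓘_s(𝕊¹; dφ / 2π) R^{-s}]` for
`0 < s < 1` and `2R 𝒦_s(R + z, R + w)` for `s > 1`. -/
def kernelR (s R : ℝ) (z w : ℂ) : EReal :=
  if s < 1 then
    ((2 * R : ℝ) : EReal) *
      ((kernelS s (R + z) (R + w) : EReal) - ((circleEnergy s * R ^ (-s) : ℝ) : EReal))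
  else ((2 * R : ℝ) : EReal) * (kernelS s (R + z) (R + w) : EReal)

/-- The kernel `𝒦_s^{(∞)}(z, w) = Γ((s - 1) / 2) / (√π Γ(s / 2)) |z - w|^{1 - s}`, `s ≠ 1`.
For `0 < s < 1` the constant is negative and the kernel vanishes on the diagonal; for `s > 1` the
constant is positive and the kernel is `+∞` on the diagonal. -/
def kernelInf (s : ℝ) (z w : ℂ) : EReal :=
  ((Real.Gamma ((s - 1) / 2) / (Real.sqrt Real.pi * Real.Gamma (s / 2)) : ℝ) : EReal) *
    (((edist z w) ^ (1 - s) : ℝ≥0∞) : EReal)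

/-- `K` is one of the kernels `𝒦_s`, `𝒦_s^{(R)}` (with `R > 0`), `𝒦_s^{(∞)}`; the last two are
defined for `s ≠ 1` only. -/
def IsAdmissibleKernel (s : ℝ) (K : ℂ → ℂ → EReal) : Prop :=
  (K = fun z w => (kernelS s z w : EReal)) ∨
  (s ≠ 1 ∧ ∃ R : ℝ, 0 < R ∧ K = kernelR s R) ∨
  (s ≠ 1 ∧ K = kernelInf s)

/-- The `K`-energy `𝒥_K[μ] = ∬ K(z, w) dμ(z) dμ(w)` of a probability measure on `A`, as an extended
Lebesgue integral (integral of the positive part minus integral of the negative part). -/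
def energy (K : ℂ → ℂ → EReal) {A : Set ℂ} (μ : ProbabilityMeasure A) : EReal :=
  ((∫⁻ p : A × A, (K p.1 p.2).toENNReal ∂((μ : Measure A).prod (μ : Measure A)) : ℝ≥0∞) : EReal)
  - ((∫⁻ p : A × A, (-(K p.1 p.2)).toENNReal ∂((μ : Measure A).prod (μ : Measure A)) : ℝ≥0∞) :
      EReal)

/-- `μ` minimizes the `K`-energy among all Borel probability measures on `A`. -/
def IsEquilibriumMeasure (K : ℂ → ℂ → EReal) {A : Set ℂ} (μ : ProbabilityMeasure A) : Prop :=
  ∀ ν : ProbabilityMeasure A, energy K μ ≤ energy K ν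

/-- The discrete energy `E_K(Z) = ∑_{j ≠ k} K(z_j, z_k)` of `Z = (z_1, …, z_N)` in `A`. -/
def configEnergy (K : ℂ → ℂ → EReal) {A : Set ℂ} {N : ℕ} (Z : Fin N → A) : EReal :=
  ∑ p ∈ (Finset.univ : Finset (Fin N)).offDiag, K (Z p.1) (Z p.2)

/-- The `N`-point `K`-energy `ℰ_K(A, N)` of `A`. -/
def minEnergy (K : ℂ → ℂ → EReal) (A : Set ℂ) (N : ℕ) : EReal :=
  ⨅ Z : Fin N → A, configEnergy K Z

/-- `Z` is a minimal `K`-energy configuration of `N` points of `A`. -/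
def IsMinimalConfig (K : ℂ → ℂ → EReal) {A : Set ℂ} {N : ℕ} (Z : Fin N → A) : Prop :=
  ∀ Z' : Fin N → A, configEnergy K Z ≤ configEnergy K Z'

/-- The normalized counting measure `(1 / N) ∑_k δ_{z_k}` on `A`. -/
def countingMeasure {A : Set ℂ} {N : ℕ} (Z : Fin N → A) : FiniteMeasure A :=
  ((N : ℝ≥0)⁻¹) • ∑ k : Fin N, (diracProba (Z k)).toFiniteMeasure

end RevolutionEnergy

end

noncomputable section

namespace RevolutionEnergy

/-! On `A × A` every admissible kernel equals `k - c`, where `k` has values in `[0, ∞]` and `c ≥ 0`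
is constant. Subtracting `c` shifts continuous energies by `c` and `N`-point energies by `c (N² -
N)`, so it is enough to treat a kernel `k` satisfying `IsEquilibriumKernel`. Strict positive
definiteness is stated there without subtraction: `I(μ) + I(ν) ≤ 2 I(μ, ν)` forces `μ = ν` when both
energies are finite.

For such `k` the argument is classical. The energy is a supremum of weakly continuous functionals,
hence lower semicontinuous on the compact space of probability measures, so a minimizer exists;
testing the midpoint of two minimizers gives uniqueness. Averaging the discrete energy over
independent points with law `μ` bounds the minimum by `N² I(μ)`. Conversely, a continuous truncation
of `k` is bounded, so the diagonal terms of an empirical measure cost only `O(1/N)`; every cluster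
point of the empirical measures is therefore a minimizer (`IsEquilibriumKernel.tendsto`).

Strict positive definiteness comes from Gaussians: `r^(-s)` is a mixture of the kernels `exp (-t
r²)`, and `r^a` with `0 < a < 2` is a mixture of `1 - exp (-t r²)`. The Gaussian energy of a
difference of measures is an integral of the squared modulus of the difference of characteristic
functions. For `𝒦_s`, rotating a measure about the axis turns its energy into a Riesz energy in
`ℝ³`, and the measure can be recovered from the rotated one.

Finite energy is where the dimension enters. `Γ(A)` is a smooth image of `A × [0, 2π]`, so this
product has nonzero Hausdorff measure in some dimension `d > s`. If every measure on `A` had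
infinite Riesz energy, minimizers for truncated kernels would have uniformly large potentials on
`A`; then every point would lie at the centre of a ball of large density, and a Vitali covering
would make the product null. Away from the axis `𝒦_s` is bounded by a multiple of `|z - w|^(-t)` for
some `t` with `s - t < 1`, which carries the finiteness over. -/

/-- The mutual energy `∬ k dμ dν` of a nonnegative kernel. -/
def mutualEnergy {X Y : Type*} [MeasurableSpace X] [MeasurableSpace Y] (k : X × Y → ℝ≥0∞)
    (μ : Measure X) (ν : Measure Y) : ℝ≥0∞ :=
  ∫⁻ p, k p ∂(μ.prod ν)

/-- The discrete energy of a tuple for a nonnegative kernel. -/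
def tupleEnergy {X : Type*} (k : X × X → ℝ≥0∞) {N : ℕ} (Z : Fin N → X) : ℝ≥0∞ :=
  ∑ p ∈ (Finset.univ : Finset (Fin N)).offDiag, k (Z p.1, Z p.2)

/-- `k` is the supremum of an increasing sequence of continuous finite functions. -/
def IsSupOfContinuous {Y : Type*} [TopologicalSpace Y] (k : Y → ℝ≥0∞) : Prop :=
  ∃ f : ℕ → C(Y, ℝ≥0), Monotone f ∧ ∀ p, k p = ⨆ n, (f n p : ℝ≥0∞)

/-- Kernels for which the equilibrium problem on `X` is well posed. -/
structure IsEquilibriumKernel {X : Type*} [TopologicalSpace X] [MeasurableSpace X]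
    (k : X × X → ℝ≥0∞) : Prop where
  approx : IsSupOfContinuous k
  symm : ∀ p : X × X, k p.swap = k p
  finite : ∃ μ : ProbabilityMeasure X, mutualEnergy k (μ : Measure X) (μ : Measure X) ≠ ⊤
  strictPosDef : ∀ μ ν : ProbabilityMeasure X,
    mutualEnergy k (μ : Measure X) (μ : Measure X) ≠ ⊤ →
    mutualEnergy k (ν : Measure X) (ν : Measure X) ≠ ⊤ →
    mutualEnergy k (μ : Measure X) (μ : Measure X) + mutualEnergy k (ν : Measure X) (ν : Measure X)
      ≤ 2 * mutualEnergy k (μ : Measure X) (ν : Measure X) → μ = ν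

theorem IsSupOfContinuous.lowerSemicontinuous {Y : Type*} [TopologicalSpace Y] {k : Y → ℝ≥0∞}
    (hk : IsSupOfContinuous k) : LowerSemicontinuous k := by
  obtain ⟨f, -, hf⟩ := hk
  have : k = fun p => ⨆ n, (f n p : ℝ≥0∞) := funext hf
  rw [this]
  exact lowerSemicontinuous_iSup fun n =>
    (ENNReal.continuous_coe.comp (f n).continuous).lowerSemicontinuous

theorem IsSupOfContinuous.measurable {Y : Type*} [TopologicalSpace Y] [MeasurableSpace Y]
    [BorelSpace Y] {k : Y → ℝ≥0∞} (hk : IsSupOfContinuous k) : Measurable k :=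
  hk.lowerSemicontinuous.measurable

theorem exists_minimal_tupleEnergy {X : Type*} [TopologicalSpace X] [CompactSpace X] [Nonempty X]
    {k : X × X → ℝ≥0∞} (hk : IsSupOfContinuous k)
    (N : ℕ) : ∃ Z : Fin N → X, ∀ Z' : Fin N → X, tupleEnergy k Z ≤ tupleEnergy k Z' := by
  have hl : LowerSemicontinuous fun Z : Fin N → X => tupleEnergy k Z := by
    refine lowerSemicontinuous_sum fun p _ => ?_
    exact hk.lowerSemicontinuous.comp (g := fun Z : Fin N → X => (Z p.1, Z p.2)) (by fun_prop)
  obtain ⟨Z, -, hZ⟩ := LowerSemicontinuousOn.exists_isMinOn Set.univ_nonempty isCompact_univ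
    (hl.lowerSemicontinuousOn _)
  exact ⟨Z, fun Z' => hZ (Set.mem_univ Z')⟩

/-! ### Bilinearity of the energy and averaging over random tuples -/

section Algebra

variable {X : Type*} [MeasurableSpace X]

theorem mutualEnergy_add_left (k : X × X → ℝ≥0∞) (μ₁ μ₂ ν : Measure X)
    [SFinite μ₁] [SFinite μ₂] [SFinite ν] :
    mutualEnergy k (μ₁ + μ₂) ν = mutualEnergy k μ₁ ν + mutualEnergy k μ₂ ν := by
  simp [mutualEnergy, Measure.add_prod, lintegral_add_measure]

theorem mutualEnergy_add_right (k : X × X → ℝ≥0∞) (μ ν₁ ν₂ : Measure X)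
    [SFinite μ] [SFinite ν₁] [SFinite ν₂] :
    mutualEnergy k μ (ν₁ + ν₂) = mutualEnergy k μ ν₁ + mutualEnergy k μ ν₂ := by
  simp [mutualEnergy, Measure.prod_add, lintegral_add_measure]

theorem mutualEnergy_smul_left (k : X × X → ℝ≥0∞) (c : ℝ≥0∞) (μ ν : Measure X) [SFinite ν] :
    mutualEnergy k (c • μ) ν = c * mutualEnergy k μ ν := by
  simp [mutualEnergy, Measure.prod_smul_left]

theorem mutualEnergy_smul_right {k : X × X → ℝ≥0∞} (hk : Measurable k) (c : ℝ≥0∞)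
    (μ ν : Measure X) [SFinite μ] [SFinite ν] :
    mutualEnergy k μ (c • ν) = c * mutualEnergy k μ ν := by
  unfold mutualEnergy
  rw [lintegral_prod _ hk.aemeasurable, lintegral_prod _ hk.aemeasurable,
    ← lintegral_const_mul _ hk.lintegral_prod_right']
  simp

theorem mutualEnergy_comm {k : X × X → ℝ≥0∞} (hs : ∀ p : X × X, k p.swap = k p)
    (μ ν : Measure X) [SFinite μ] [SFinite ν] : mutualEnergy k μ ν = mutualEnergy k ν μ := by
  unfold mutualEnergy
  rw [← lintegral_prod_swap]
  simp_rw [hs]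

/-- Distinct coordinates of a product measure are independent, so their joint law is `μ.prod μ`. -/
theorem lintegral_pi_pair {k : X × X → ℝ≥0∞} (hk : Measurable k) (μ : ProbabilityMeasure X)
    {N : ℕ} {i j : Fin N} (hij : i ≠ j) :
    ∫⁻ Z : Fin N → X, k (Z i, Z j) ∂(Measure.pi fun _ => (μ : Measure X)) =
      mutualEnergy k (μ : Measure X) (μ : Measure X) := by
  have h1 : ProbabilityTheory.IndepFun (fun Z : Fin N → X => Z i) (fun Z => Z j)
      (Measure.pi fun _ => (μ : Measure X)) :=
    (ProbabilityTheory.iIndepFun_pi (μ := fun _ : Fin N => (μ : Measure X))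
      (X := fun _ => id) (fun _ => aemeasurable_id)).indepFun hij
  rw [ProbabilityTheory.indepFun_iff_map_prod_eq_prod_map_map
    (measurable_pi_apply i).aemeasurable (measurable_pi_apply j).aemeasurable] at h1
  rw [(measurePreserving_eval (fun _ : Fin N => (μ : Measure X)) i).map_eq,
    (measurePreserving_eval (fun _ : Fin N => (μ : Measure X)) j).map_eq] at h1
  rw [mutualEnergy, ← h1, lintegral_map hk (by fun_prop)]

/-- A minimum is at most the average over independent points with law `μ`, and each of the `N² - N`
off-diagonal pairs contributes one copy of the energy. -/
theorem tupleEnergy_le_of_minimal {k : X × X → ℝ≥0∞} (hk : Measurable k)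
    (μ : ProbabilityMeasure X) {N : ℕ} {Z : Fin N → X}
    (hZ : ∀ Z' : Fin N → X, tupleEnergy k Z ≤ tupleEnergy k Z') :
    tupleEnergy k Z ≤ (N : ℝ≥0∞) ^ 2 * mutualEnergy k (μ : Measure X) (μ : Measure X) := by
  calc tupleEnergy k Z
      = ∫⁻ _, tupleEnergy k Z ∂(Measure.pi fun _ : Fin N => (μ : Measure X)) := by simp
    _ ≤ ∫⁻ Z', tupleEnergy k Z' ∂(Measure.pi fun _ : Fin N => (μ : Measure X)) :=
        lintegral_mono hZ
    _ = ∑ p ∈ (Finset.univ : Finset (Fin N)).offDiag,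
          mutualEnergy k (μ : Measure X) (μ : Measure X) := by
        unfold tupleEnergy
        rw [lintegral_finsetSum _ fun p _ => hk.comp
          (g := k) (f := fun Z' : Fin N → X => (Z' p.1, Z' p.2)) (by fun_prop)]
        exact Finset.sum_congr rfl fun p hp =>
          lintegral_pi_pair hk μ (Finset.mem_offDiag.1 hp).2.2
    _ ≤ _ := by
        rw [Finset.sum_const, nsmul_eq_mul, Finset.offDiag_card]
        gcongr
        simp only [Finset.card_univ, Fintype.card_fin]
        rw [sq]
        exact_mod_cast Nat.sub_le _ _

end Algebra

/-! ### Energy minimizers on a compact space -/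

section MutualEnergy

variable {X : Type*} [MetricSpace X] [CompactSpace X] [MeasurableSpace X] [BorelSpace X]

theorem continuous_mutualEnergy (f : C(X × X, ℝ≥0)) :
    Continuous fun μ : ProbabilityMeasure X =>
      mutualEnergy (fun p => (f p : ℝ≥0∞)) (μ : Measure X) (μ : Measure X) := by
  have h1 : Continuous fun μ : ProbabilityMeasure X => μ.prod μ :=
    ProbabilityMeasure.continuous_prod.comp (continuous_id.prodMk continuous_id)
  rw [continuous_iff_continuousAt]
  intro μ
  have := ProbabilityMeasure.tendsto_iff_forall_lintegral_tendsto.1 (h1.tendsto μ)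
    (BoundedContinuousFunction.mkOfCompact f)
  simpa [ContinuousAt, mutualEnergy] using this

/-- Monotone convergence. This reduces every limit argument to continuous bounded kernels, whose
energy is weakly continuous. -/
theorem mutualEnergy_eq_iSup {f : ℕ → C(X × X, ℝ≥0)} (hf : Monotone f) {k : X × X → ℝ≥0∞}
    (hk : ∀ p, k p = ⨆ n, (f n p : ℝ≥0∞)) (μ ν : Measure X) :
    mutualEnergy k μ ν = ⨆ n, mutualEnergy (fun p => (f n p : ℝ≥0∞)) μ ν := by
  unfold mutualEnergy
  simp_rw [hk]
  refine lintegral_iSup (fun n => (ENNReal.continuous_coe.comp (f n).continuous).measurable) ?_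
  intro m n hmn p
  exact ENNReal.coe_le_coe.2 (hf hmn p)

theorem lowerSemicontinuous_mutualEnergy {k : X × X → ℝ≥0∞} (hk : IsSupOfContinuous k) :
    LowerSemicontinuous fun μ : ProbabilityMeasure X =>
      mutualEnergy k (μ : Measure X) (μ : Measure X) := by
  obtain ⟨f, hf, hkf⟩ := hk
  simp_rw [mutualEnergy_eq_iSup hf hkf]
  exact lowerSemicontinuous_iSup fun n => (continuous_mutualEnergy (f n)).lowerSemicontinuous

theorem exists_minimal_mutualEnergy [Nonempty X] {k : X × X → ℝ≥0∞} (hk : IsSupOfContinuous k) :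
    ∃ μ : ProbabilityMeasure X, ∀ ν : ProbabilityMeasure X,
      mutualEnergy k (μ : Measure X) (μ : Measure X) ≤
        mutualEnergy k (ν : Measure X) (ν : Measure X) := by
  have : Nonempty (ProbabilityMeasure X) := ⟨diracProba (Classical.arbitrary X)⟩
  obtain ⟨μ, -, hμ⟩ := LowerSemicontinuousOn.exists_isMinOn Set.univ_nonempty isCompact_univ
    ((lowerSemicontinuous_mutualEnergy hk).lowerSemicontinuousOn _)
  exact ⟨μ, fun ν => hμ (Set.mem_univ ν)⟩

/-- Convex combination of two probability measures. -/
def mixture (a b : ℝ≥0) (hab : a + b = 1) (μ ν : ProbabilityMeasure X) : ProbabilityMeasure X :=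
  ⟨(a : ℝ≥0∞) • (μ : Measure X) + (b : ℝ≥0∞) • (ν : Measure X), ⟨by
    simp only [Measure.coe_add, Measure.coe_smul, Pi.add_apply, Pi.smul_apply, measure_univ,
      smul_eq_mul, mul_one]
    exact_mod_cast hab⟩⟩

theorem mutualEnergy_mixture {k : X × X → ℝ≥0∞} (hk : Measurable k)
    (hs : ∀ p : X × X, k p.swap = k p) (a b : ℝ≥0) (hab : a + b = 1)
    (μ ν : ProbabilityMeasure X) :
    mutualEnergy k (mixture a b hab μ ν : Measure X) (mixture a b hab μ ν : Measure X) =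
      a * a * mutualEnergy k (μ : Measure X) (μ : Measure X)
      + 2 * (a * b * mutualEnergy k (μ : Measure X) (ν : Measure X))
      + b * b * mutualEnergy k (ν : Measure X) (ν : Measure X) := by
  have : (mixture a b hab μ ν : Measure X)
    = (a : ℝ≥0∞) • (μ : Measure X) + (b : ℝ≥0∞) • (ν : Measure X) := rfl
  rw [this, mutualEnergy_add_left, mutualEnergy_smul_left, mutualEnergy_smul_left,
    mutualEnergy_add_right, mutualEnergy_add_right, mutualEnergy_smul_right hk,
    mutualEnergy_smul_right hk, mutualEnergy_smul_right hk, mutualEnergy_smul_right hk,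
    mutualEnergy_comm hs (ν : Measure X) (μ : Measure X)]
  ring

/-- The midpoint of `μ` and `ν` has energy at least `W`, the common minimum; expanding the square
gives `W ≤ I(μ, ν)`, which is the hypothesis of strict positive definiteness. -/
theorem IsEquilibriumKernel.eq_of_minimal {k : X × X → ℝ≥0∞} (hk : IsEquilibriumKernel k)
    {μ ν : ProbabilityMeasure X}
    (hμ : ∀ ρ : ProbabilityMeasure X, mutualEnergy k (μ : Measure X) (μ : Measure X) ≤
      mutualEnergy k (ρ : Measure X) (ρ : Measure X))
    (hν : mutualEnergy k (ν : Measure X) (ν : Measure X) ≤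
      mutualEnergy k (μ : Measure X) (μ : Measure X)) : μ = ν := by
  obtain ⟨ρ, hρ⟩ := hk.finite
  have hfin := ((hμ ρ).trans_lt hρ.lt_top).ne
  have hm := hk.approx.measurable
  have hν' := le_antisymm hν (hμ ν)
  refine hk.strictPosDef μ ν hfin (hν' ▸ hfin) ?_
  have hab : (1 / 2 : ℝ≥0) + 1 / 2 = 1 := by norm_num
  have h1 := hμ (mixture (1/2) (1/2) hab μ ν)
  rw [mutualEnergy_mixture hm hk.symm, hν'] at h1
  rw [hν']
  generalize mutualEnergy k (μ : Measure X) (μ : Measure X) = W at *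
  generalize mutualEnergy k (μ : Measure X) (ν : Measure X) = V at *
  by_cases hV : V = ⊤
  · simp [hV]
  lift W to ℝ≥0 using hfin
  lift V to ℝ≥0 using hV
  norm_cast at h1 ⊢
  rw [← NNReal.coe_le_coe] at h1 ⊢
  push_cast at h1 ⊢
  linarith

/-- For a continuous kernel the potential of a minimizer is at least its energy, everywhere. -/
theorem mutualEnergy_le_potential {k : C(X × X, ℝ≥0)} (hs : ∀ p : X × X, k p.swap = k p)
    {μ : ProbabilityMeasure X}
    (hμ : ∀ ν : ProbabilityMeasure X,
      mutualEnergy (fun p => (k p : ℝ≥0∞)) (μ : Measure X) (μ : Measure X) ≤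
        mutualEnergy (fun p => (k p : ℝ≥0∞)) (ν : Measure X) (ν : Measure X)) (x : X) :
    mutualEnergy (fun p => (k p : ℝ≥0∞)) (μ : Measure X) (μ : Measure X) ≤
      ∫⁻ y, k (x, y) ∂(μ : Measure X) := by
  have hm : Measurable fun p => (k p : ℝ≥0∞) :=
    (ENNReal.continuous_coe.comp k.continuous).measurable
  have hs' : ∀ p : X × X, (fun p => (k p : ℝ≥0∞)) p.swap = (fun p => (k p : ℝ≥0∞)) p :=
    fun p => congrArg _ (hs p)
  have hV : ∫⁻ y, k (x, y) ∂(μ : Measure X) =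
      mutualEnergy (fun p => (k p : ℝ≥0∞)) (μ : Measure X) (diracProba x : Measure X) := by
    have : (diracProba x : Measure X) = Measure.dirac x := rfl
    rw [this, mutualEnergy_comm hs', mutualEnergy, lintegral_prod _ hm.aemeasurable,
      lintegral_dirac' _ hm.lintegral_prod_right']
  have hfin : ∀ μ ν : ProbabilityMeasure X,
      mutualEnergy (fun p => (k p : ℝ≥0∞)) (μ : Measure X) (ν : Measure X) ≠ ⊤ := by
    intro μ ν
    obtain ⟨C, hC⟩ := (isCompact_range k.continuous).bddAbove
    refine ((lintegral_mono (g := fun _ => (C : ℝ≥0∞)) fun p =>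
      ENNReal.coe_le_coe.2 (hC ⟨p, rfl⟩)).trans_lt ?_).ne
    simp
  rw [hV]
  -- First variation: move a small mass `ε` from `μ` to the point `x`.
  have key : ∀ ε : ℝ≥0, ∀ h : ε ≤ 1, _ := fun ε h =>
    (hμ (mixture (1 - ε) ε (tsub_add_cancel_of_le h) μ (diracProba x)))
  simp only [mutualEnergy_mixture hm hs'] at key
  have h1 := hfin μ μ
  have h2 := hfin μ (diracProba x)
  have h3 := hfin (diracProba x) (diracProba x)
  generalize mutualEnergy (fun p => (k p : ℝ≥0∞)) (μ : Measure X) (μ : Measure X) = W at *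
  generalize mutualEnergy (fun p => (k p : ℝ≥0∞)) (μ : Measure X) (diracProba x : Measure X) = V
    at *
  generalize mutualEnergy (fun p => (k p : ℝ≥0∞)) (diracProba x : Measure X)
    (diracProba x : Measure X) = U at *
  lift W to ℝ≥0 using h1
  lift V to ℝ≥0 using h2
  lift U to ℝ≥0 using h3
  norm_cast at key ⊢
  rw [← NNReal.coe_le_coe]
  by_contra! hlt
  obtain ⟨d, hd⟩ : ∃ d : ℝ, d = W - V := ⟨_, rfl⟩
  have hdpos : 0 < d := by linarith
  -- With `V = W - d`, the energy changes by `ε (-ε W - 2 (1 - ε) d + ε U)`. The choice `ε = d / (W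
  -- + U + d)` makes the bracket `-2 ε W - (1 - ε) d < 0`, contradicting minimality.
  obtain ⟨M, hM⟩ : ∃ M : ℝ, M = W + U + d := ⟨_, rfl⟩
  have hMpos : 0 < M := by rw [hM]; positivity
  have hε : d / M ≤ 1 := by rw [div_le_one hMpos, hM]; linarith [W.2, U.2]
  have hε0 : 0 < d / M := by positivity
  obtain ⟨ε, he⟩ : ∃ ε : ℝ≥0, (ε : ℝ) = d / M := ⟨⟨d / M, hε0.le⟩, rfl⟩
  have hε1 : ε ≤ 1 := by rw [← NNReal.coe_le_coe, he]; exact_mod_cast hε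
  have h6 := key ε hε1
  rw [← NNReal.coe_le_coe] at h6
  push_cast [NNReal.coe_sub hε1] at h6
  rw [← he] at hε0
  have he' : (ε : ℝ) * M = d := by rw [he]; exact div_mul_cancel₀ _ hMpos.ne'
  have hV' : (V : ℝ) = W - d := by rw [hd]; ring
  rw [hV'] at h6
  rw [hM] at he'
  have h4 : 0 ≤ (ε : ℝ) * (-ε * W - 2 * (1 - ε) * d + ε * U) := by nlinarith
  have h5 := (mul_nonneg_iff_of_pos_left hε0).1 h4
  have hW0 : (0 : ℝ) < W := lt_of_le_of_lt V.2 hlt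
  have h7 := mul_pos hε0 hW0
  have h8 : (ε : ℝ) * d ≤ 1 * d := by gcongr; exact_mod_cast hε1
  nlinarith

end MutualEnergy

/-! ### Asymptotics of minimal configurations -/

section Discrete

variable {X : Type*} [MetricSpace X] [CompactSpace X] [MeasurableSpace X] [BorelSpace X]

/-- The diagonal sum may be infinite for a singular kernel, so the identity is useful for its
bounded truncations. -/
theorem mutualEnergy_empirical {k : X × X → ℝ≥0∞} (hk : Measurable k) {N : ℕ} (Z : Fin N → X)
    {ν : Measure X} (hν : ν = (N : ℝ≥0∞)⁻¹ • ∑ i, Measure.dirac (Z i)) :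
    mutualEnergy k ν ν =
      (N : ℝ≥0∞)⁻¹ ^ 2 * (tupleEnergy k Z + ∑ i, k (Z i, Z i)) := by
  have hin : ∀ x : X, ∫⁻ y, k (x, y) ∂ν = (N : ℝ≥0∞)⁻¹ * ∑ j, k (x, Z j) := by
    intro x
    simp [hν, lintegral_finsetSum_measure]
  have hf : SFinite ν := by rw [hν]; infer_instance
  rw [mutualEnergy, lintegral_prod _ hk.aemeasurable]
  simp_rw [hin]
  have hd : tupleEnergy k Z + ∑ i, k (Z i, Z i) = ∑ i, ∑ j, k (Z i, Z j) := by
    rw [← Finset.sum_product', tupleEnergy, ← Finset.diag_union_offDiag,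
      Finset.sum_union (Finset.disjoint_diag_offDiag _), Finset.sum_diag, add_comm]
  rw [hd, hν, lintegral_smul_measure, lintegral_finsetSum_measure]
  simp only [lintegral_dirac, smul_eq_mul]
  rw [← Finset.mul_sum]
  ring

/-- The empirical measures of minimal configurations converge to the equilibrium measure and the
normalized minimal energies converge to its energy. -/
theorem IsEquilibriumKernel.tendsto {k : X × X → ℝ≥0∞} (hk : IsEquilibriumKernel k)
    {μ : ProbabilityMeasure X}
    (hμ : ∀ ρ : ProbabilityMeasure X, mutualEnergy k (μ : Measure X) (μ : Measure X) ≤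
      mutualEnergy k (ρ : Measure X) (ρ : Measure X))
    {Z : (N : ℕ) → Fin N → X} (hZ : ∀ N, 2 ≤ N → ∀ Z' : Fin N → X,
      tupleEnergy k (Z N) ≤ tupleEnergy k Z')
    {ν : ℕ → ProbabilityMeasure X}
    (hν : ∀ N, 2 ≤ N → (ν N : Measure X) = (N : ℝ≥0∞)⁻¹ • ∑ i, Measure.dirac (Z N i)) :
    Tendsto ν atTop (𝓝 μ) ∧
      Tendsto (fun N => tupleEnergy k (Z N) / (N : ℝ≥0∞) ^ 2) atTop
        (𝓝 (mutualEnergy k (μ : Measure X) (μ : Measure X))) := by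
  have hm := hk.approx.measurable
  obtain ⟨f, hf, hkf⟩ := hk.approx
  set W := mutualEnergy k (μ : Measure X) (μ : Measure X) with hW
  have hle : ∀ N, 2 ≤ N → tupleEnergy k (Z N) / (N : ℝ≥0∞) ^ 2 ≤ W := by
    intro N hN
    refine ENNReal.div_le_of_le_mul ?_
    rw [mul_comm]
    exact tupleEnergy_le_of_minimal hm μ (hZ N hN)
  have hbd : ∀ n, ∃ C : ℝ≥0, ∀ p, f n p ≤ C := fun n => by
    obtain ⟨C, hC⟩ := (isCompact_range (f n).continuous).bddAbove
    exact ⟨C, fun p => hC ⟨p, rfl⟩⟩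
  choose C hC using hbd
  -- The truncation is at most `k` off the diagonal and at most `C n` on it; the `N` diagonal terms,
  -- weighted by `N⁻²`, contribute at most `C n / N`.
  have hlow : ∀ n N, 2 ≤ N →
      mutualEnergy (fun p => (f n p : ℝ≥0∞)) (ν N : Measure X) (ν N : Measure X) ≤
        tupleEnergy k (Z N) / (N : ℝ≥0∞) ^ 2 + C n / N := by
    intro n N hN
    have hN0 : (N : ℝ≥0∞) ≠ 0 := by simp; omega
    rw [mutualEnergy_empirical (k := fun p => (f n p : ℝ≥0∞))
      (ENNReal.continuous_coe.comp (f n).continuous).measurable (Z N)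
      (hν N hN), mul_add, ENNReal.div_eq_inv_mul, ENNReal.inv_pow]
    gcongr
    · unfold tupleEnergy
      refine Finset.sum_le_sum fun p _ => ?_
      rw [hkf]
      exact le_iSup (fun n => (f n (Z N p.1, Z N p.2) : ℝ≥0∞)) n
    · calc (N : ℝ≥0∞)⁻¹ ^ 2 * ∑ i, (f n (Z N i, Z N i) : ℝ≥0∞)
          ≤ (N : ℝ≥0∞)⁻¹ ^ 2 * ∑ i : Fin N, (C n : ℝ≥0∞) := by
            gcongr
            exact hC _ _
        _ = (N : ℝ≥0∞)⁻¹ * N * ((N : ℝ≥0∞)⁻¹ * C n) := by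
            rw [Finset.sum_const, Finset.card_univ, Fintype.card_fin, nsmul_eq_mul]
            ring
        _ = (C n : ℝ≥0∞) / N := by
            rw [ENNReal.inv_mul_cancel hN0 (by simp), one_mul, ENNReal.div_eq_inv_mul]
  have hCN : ∀ n, Tendsto (fun N : ℕ => (C n : ℝ≥0∞) / N) atTop (𝓝 0) := fun n => by
    simpa using ENNReal.Tendsto.const_div (a := (C n : ℝ≥0∞)) ENNReal.tendsto_nat_nhds_top
      (Or.inr (by simp))
  have hconv : Tendsto ν atTop (𝓝 μ) := by
    -- By compactness each ultrafilter has a limit `ρ`. Its truncated energies are at most `W`,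
    -- hence so is its energy, and uniqueness identifies it with `μ`.
    rw [tendsto_iff_ultrafilter]
    intro g hg
    obtain ⟨ρ, -, hρ⟩ := isCompact_univ.ultrafilter_le_nhds (g.map ν) (by simp)
    have hρ' : Tendsto ν g (𝓝 ρ) := hρ
    suffices μ = ρ by rwa [this]
    refine hk.eq_of_minimal hμ ?_
    rw [mutualEnergy_eq_iSup hf hkf]
    refine iSup_le fun n => ?_
    have h1 := ((continuous_mutualEnergy (f n)).tendsto ρ).comp hρ'
    have h2 : Tendsto (fun N : ℕ => W + (C n : ℝ≥0∞) / N) g (𝓝 (W + 0)) :=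
      (tendsto_const_nhds.add (hCN n)).mono_left hg
    rw [add_zero] at h2
    refine le_of_tendsto_of_tendsto h1 h2 (hg ?_)
    filter_upwards [eventually_ge_atTop 2] with N hN
    exact (hlow n N hN).trans (by gcongr; exact hle N hN)
  refine ⟨hconv, ?_⟩
  refine tendsto_of_le_liminf_of_limsup_le ?_ ?_
  · rw [hW, mutualEnergy_eq_iSup hf hkf]
    refine iSup_le fun n => ?_
    have h1 := ENNReal.Tendsto.sub (((continuous_mutualEnergy (f n)).tendsto μ).comp hconv)
      (hCN n) (Or.inr (by simp))
    rw [tsub_zero] at h1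
    rw [← h1.liminf_eq]
    refine liminf_le_liminf ?_
    filter_upwards [eventually_ge_atTop 2] with N hN
    exact tsub_le_iff_right.2 (hlow n N hN)
  · refine limsup_le_of_le (by isBoundedDefault) ?_
    filter_upwards [eventually_ge_atTop 2] with N hN
    exact hle N hN

end Discrete

/-! ### Positive definiteness of the Gaussian kernel -/

section GaussEnergy

variable {E : Type*} [NormedAddCommGroup E] [MeasurableSpace E]

/-- The mutual energy of two measures for the Gaussian kernel `exp (-t ‖x - y‖²)`. -/
def gaussEnergy (t : ℝ) (μ ν : Measure E) : ℝ :=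
  ∫ p : E × E, Real.exp (-(t * ‖p.1 - p.2‖ ^ 2)) ∂(μ.prod ν)

theorem gaussEnergy_comm (t : ℝ) (μ ν : Measure E) [SFinite μ] [SFinite ν] :
    gaussEnergy t μ ν = gaussEnergy t ν μ := by
  unfold gaussEnergy
  rw [← integral_prod_swap]
  simp [norm_sub_rev]

theorem gaussEnergy_nonneg (t : ℝ) (μ ν : Measure E) : 0 ≤ gaussEnergy t μ ν :=
  integral_nonneg fun _ => (Real.exp_pos _).le

end GaussEnergy

section Gaussian

open ProbabilityTheory ComplexConjugate

variable {E : Type*} [NormedAddCommGroup E] [InnerProductSpace ℝ E] [FiniteDimensional ℝ E]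
  [MeasurableSpace E] [BorelSpace E]

/-- Full support lets a continuous function that vanishes almost everywhere be recognized as zero;
this is used to identify characteristic functions at every frequency. -/
instance isOpenPosMeasure_stdGaussian : (stdGaussian E).IsOpenPosMeasure := by
  have h : (gaussianReal 0 1).IsOpenPosMeasure :=
    (gaussianReal_absolutelyContinuous' 0 one_ne_zero).isOpenPosMeasure
  refine Continuous.isOpenPosMeasure_map (by fun_prop) fun x => ?_
  exact ⟨fun i => (stdOrthonormalBasis ℝ E).repr x i, (stdOrthonormalBasis ℝ E).sum_repr x⟩

theorem integrable_gauss {t : ℝ} (ht : 0 ≤ t) (μ ν : Measure E) [IsFiniteMeasure μ]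
    [IsFiniteMeasure ν] :
    Integrable (fun p : E × E => Real.exp (-(t * ‖p.1 - p.2‖ ^ 2))) (μ.prod ν) := by
  refine Integrable.of_bound (C := 1) (by fun_prop) (ae_of_all _ fun p => ?_)
  rw [Real.norm_eq_abs, Real.abs_exp, Real.exp_le_one_iff]
  have : 0 ≤ t * ‖p.1 - p.2‖ ^ 2 := by positivity
  linarith

/-- `exp (-t ‖v‖²)` is the characteristic function of the standard Gaussian at `√(2 t) • v`. Writing
it as an integral over `ξ` and exchanging integrals separates the two variables. -/
theorem gaussEnergy_eq_integral_charFun {t : ℝ} (ht : 0 ≤ t) (μ ν : Measure E)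
    [IsProbabilityMeasure μ] [IsProbabilityMeasure ν] :
    (gaussEnergy t μ ν : ℂ) = ∫ ξ, charFun μ (√(2 * t) • ξ) * conj (charFun ν (√(2 * t) • ξ))
      ∂(stdGaussian E) := by
  have h1 : ∀ p : E × E, ((Real.exp (-(t * ‖p.1 - p.2‖ ^ 2)) : ℝ) : ℂ) =
      ∫ ξ, Complex.exp ((inner ℝ p.1 (√(2 * t) • ξ) : ℝ) * Complex.I) *
        conj (Complex.exp ((inner ℝ p.2 (√(2 * t) • ξ) : ℝ) * Complex.I)) ∂(stdGaussian E) := by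
    intro p
    have h2 := charFun_stdGaussian (√(2 * t) • (p.1 - p.2))
    rw [norm_smul, Complex.ofReal_mul, mul_pow, Real.norm_of_nonneg (Real.sqrt_nonneg _)] at h2
    rw [charFun_apply] at h2
    have h3 : Complex.exp (-((√(2 * t) : ℝ) ^ 2 * (‖p.1 - p.2‖ : ℂ) ^ 2 : ℂ) / 2) =
        ((Real.exp (-(t * ‖p.1 - p.2‖ ^ 2)) : ℝ) : ℂ) := by
      rw [← Complex.ofReal_pow, Real.sq_sqrt (by positivity)]
      push_cast
      congr 1
      ring
    rw [← h3]
    rw [← h2]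
    refine integral_congr_ae (ae_of_all _ fun ξ => ?_)
    simp only
    rw [← Complex.exp_conj, ← Complex.exp_add]
    congr 1
    simp only [map_mul, Complex.conj_ofReal, Complex.conj_I, inner_smul_right, inner_sub_right]
    rw [real_inner_comm p.1, real_inner_comm p.2]
    push_cast
    ring
  have h4 : ∀ ξ : E, charFun μ (√(2 * t) • ξ) * conj (charFun ν (√(2 * t) • ξ)) =
      ∫ p : E × E, Complex.exp ((inner ℝ p.1 (√(2 * t) • ξ) : ℝ) * Complex.I) *
        conj (Complex.exp ((inner ℝ p.2 (√(2 * t) • ξ) : ℝ) * Complex.I)) ∂(μ.prod ν) := by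
    intro ξ
    rw [integral_prod_mul (fun x => Complex.exp ((inner ℝ x (√(2 * t) • ξ) : ℝ) * Complex.I))
      (fun y => conj (Complex.exp ((inner ℝ y (√(2 * t) • ξ) : ℝ) * Complex.I))), integral_conj,
      charFun_apply, charFun_apply]
  simp_rw [h4]
  rw [gaussEnergy, ← integral_complex_ofReal]
  simp_rw [h1]
  refine integral_integral_swap (Integrable.of_bound (C := 1) ?_ (ae_of_all _ fun q => ?_))
  · refine Continuous.aestronglyMeasurable ?_
    unfold Function.uncurry
    fun_prop
  · simp [Function.uncurry, Complex.norm_exp]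

theorem gaussEnergy_polarization {t : ℝ} (ht : 0 ≤ t) (μ ν : Measure E)
    [IsProbabilityMeasure μ] [IsProbabilityMeasure ν] :
    gaussEnergy t μ μ + gaussEnergy t ν ν - 2 * gaussEnergy t μ ν =
      ∫ ξ, ‖charFun μ (√(2 * t) • ξ) - charFun ν (√(2 * t) • ξ)‖ ^ 2 ∂(stdGaussian E) := by
  have hint : ∀ (μ ν : Measure E) [IsProbabilityMeasure μ] [IsProbabilityMeasure ν],
      Integrable (fun ξ : E => charFun μ (√(2 * t) • ξ) * conj (charFun ν (√(2 * t) • ξ)))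
        (stdGaussian E) := by
    intro μ ν _ _
    have h1 : Continuous (charFun μ) := continuous_charFun
    have h2 : Continuous (charFun ν) := continuous_charFun
    refine Integrable.of_bound (C := 1) ?_ (ae_of_all _ fun ξ => ?_)
    · refine Continuous.aestronglyMeasurable ?_
      fun_prop
    · rw [norm_mul, RCLike.norm_conj]
      exact mul_le_one₀ (norm_charFun_le_one _) (norm_nonneg _) (norm_charFun_le_one _)
  have h : ((gaussEnergy t μ μ + gaussEnergy t ν ν - (gaussEnergy t μ ν + gaussEnergy t ν μ) : ℝ)
      : ℂ) = ∫ ξ, ((‖charFun μ (√(2 * t) • ξ) - charFun ν (√(2 * t) • ξ)‖ ^ 2 : ℝ) : ℂ)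
        ∂(stdGaussian E) := by
    push_cast
    simp_rw [gaussEnergy_eq_integral_charFun ht]
    rw [← integral_add (hint μ μ) (hint ν ν), ← integral_add (hint μ ν) (hint ν μ),
      ← integral_sub (by exact (hint μ μ).add (hint ν ν)) (by exact (hint μ ν).add (hint ν μ))]
    refine integral_congr_ae (ae_of_all _ fun ξ => ?_)
    simp only
    rw [← Complex.mul_conj', map_sub]
    ring
  rw [integral_complex_ofReal, Complex.ofReal_inj, gaussEnergy_comm t ν μ] at h
  rw [← h]
  ring

theorem two_mul_gaussEnergy_le {t : ℝ} (ht : 0 ≤ t) (μ ν : Measure E)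
    [IsProbabilityMeasure μ] [IsProbabilityMeasure ν] :
    2 * gaussEnergy t μ ν ≤ gaussEnergy t μ μ + gaussEnergy t ν ν := by
  have := gaussEnergy_polarization ht μ ν
  have h : 0 ≤ ∫ ξ, ‖charFun μ (√(2 * t) • ξ) - charFun ν (√(2 * t) • ξ)‖ ^ 2 ∂(stdGaussian E) :=
    integral_nonneg fun ξ => by positivity
  linarith

/-- The polarization integral must vanish, so the characteristic functions agree at all `√(2 t) •
ξ`; since `t > 0` these are all frequencies. -/
theorem eq_of_gaussEnergy_le {t : ℝ} (ht : 0 < t) {μ ν : Measure E}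
    [IsProbabilityMeasure μ] [IsProbabilityMeasure ν]
    (h : gaussEnergy t μ μ + gaussEnergy t ν ν ≤ 2 * gaussEnergy t μ ν) : μ = ν := by
  have h1 : Continuous (charFun μ) := continuous_charFun
  have h2 : Continuous (charFun ν) := continuous_charFun
  have h0 : ∫ ξ, ‖charFun μ (√(2 * t) • ξ) - charFun ν (√(2 * t) • ξ)‖ ^ 2 ∂(stdGaussian E) = 0 := by
    have := gaussEnergy_polarization ht.le μ ν
    have h : 0 ≤ ∫ ξ, ‖charFun μ (√(2 * t) • ξ) - charFun ν (√(2 * t) • ξ)‖ ^ 2 ∂(stdGaussian E) :=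
      integral_nonneg fun ξ => by positivity
    linarith
  have hcont : Continuous fun ξ : E =>
      ‖charFun μ (√(2 * t) • ξ) - charFun ν (√(2 * t) • ξ)‖ ^ 2 := by fun_prop
  rw [integral_eq_zero_iff_of_nonneg (fun ξ => by positivity)] at h0
  · have h3 := (hcont.ae_eq_iff_eq (stdGaussian E) continuous_const).1 h0
    refine Measure.ext_of_charFun (funext fun ξ => ?_)
    have h4 := congrFun h3 ((√(2 * t))⁻¹ • ξ)
    have hc : √(2 * t) ≠ 0 := (Real.sqrt_pos.2 (by positivity)).ne'
    rw [smul_smul, mul_inv_cancel₀ hc, one_smul] at h4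
    exact sub_eq_zero.1 (norm_eq_zero.1 (pow_eq_zero_iff two_ne_zero |>.1 h4))
  · refine Integrable.of_bound (C := 4) hcont.aestronglyMeasurable (ae_of_all _ fun ξ => ?_)
    rw [norm_pow, norm_norm]
    have : ‖charFun μ (√(2 * t) • ξ) - charFun ν (√(2 * t) • ξ)‖ ≤ 2 := by
      refine (norm_sub_le _ _).trans ?_
      linarith [norm_charFun_le_one (μ := μ) (√(2 * t) • ξ),
        norm_charFun_le_one (μ := ν) (√(2 * t) • ξ)]
    calc _ ≤ (2 : ℝ) ^ 2 := by gcongr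
      _ = 4 := by norm_num

theorem mutualEnergy_gauss {t : ℝ} (ht : 0 ≤ t) (μ ν : Measure E) [IsFiniteMeasure μ]
    [IsFiniteMeasure ν] :
    mutualEnergy (fun p : E × E => ENNReal.ofReal (Real.exp (-(t * ‖p.1 - p.2‖ ^ 2)))) μ ν =
      ENNReal.ofReal (gaussEnergy t μ ν) := by
  rw [gaussEnergy, ofReal_integral_eq_lintegral_ofReal (integrable_gauss ht μ ν)
    (ae_of_all _ fun p => (Real.exp_pos _).le), mutualEnergy]

theorem gaussEnergy_le_one {t : ℝ} (ht : 0 ≤ t) (μ ν : Measure E)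
    [IsProbabilityMeasure μ] [IsProbabilityMeasure ν] : gaussEnergy t μ ν ≤ 1 := by
  calc gaussEnergy t μ ν ≤ ∫ p : E × E, 1 ∂(μ.prod ν) := by
        refine integral_mono (integrable_gauss ht μ ν) (integrable_const _) fun p => ?_
        simp only [Real.exp_le_one_iff]
        have : 0 ≤ t * ‖p.1 - p.2‖ ^ 2 := by positivity
        linarith
    _ = 1 := by simp

theorem mutualEnergy_one_sub_gauss {t : ℝ} (ht : 0 ≤ t) (μ ν : Measure E) [IsProbabilityMeasure μ]
    [IsProbabilityMeasure ν] :
    mutualEnergy (fun p : E × E => ENNReal.ofReal (1 - Real.exp (-(t * ‖p.1 - p.2‖ ^ 2)))) μ ν =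
      ENNReal.ofReal (1 - gaussEnergy t μ ν) := by
  have h1 : 1 - gaussEnergy t μ ν =
      ∫ p : E × E, (1 - Real.exp (-(t * ‖p.1 - p.2‖ ^ 2))) ∂(μ.prod ν) := by
    rw [integral_sub (integrable_const _) (integrable_gauss ht μ ν)]
    simp [gaussEnergy]
  rw [h1, ofReal_integral_eq_lintegral_ofReal
    (by exact (integrable_const _).sub (integrable_gauss ht μ ν)) (ae_of_all _ fun p => ?_), mutualEnergy]
  have : 0 ≤ t * ‖p.1 - p.2‖ ^ 2 := by positivity
  simp only [Pi.zero_apply, sub_nonneg, Real.exp_le_one_iff]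
  linarith

end Gaussian

/-! ### Powers of the distance as mixtures of Gaussians -/

section Riesz

/-- This is the Gamma integral after scaling; at `r = 0` both sides are infinite, so the formula
also covers the diagonal. -/
theorem lintegral_rpow_mul_exp {a : ℝ} (ha : 0 < a) {r : ℝ} (hr : 0 ≤ r) :
    ∫⁻ t in Set.Ioi (0 : ℝ), ENNReal.ofReal (t ^ (a - 1)) * ENNReal.ofReal (Real.exp (-(t * r))) =
      ENNReal.ofReal (Real.Gamma a) * ENNReal.ofReal r ^ (-a) := by
  rcases hr.eq_or_lt with rfl | hr
  · have h1 : ENNReal.ofReal (Real.Gamma a) ≠ 0 := by simpa using Real.Gamma_pos_of_pos ha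
    rw [ENNReal.ofReal_zero, ENNReal.zero_rpow_of_neg (by linarith), ENNReal.mul_top h1]
    by_contra h
    refine not_integrableOn_Ioi_rpow (a - 1) ⟨by fun_prop, ?_⟩
    rw [hasFiniteIntegral_iff_norm]
    refine lt_of_le_of_lt (le_of_eq ?_) (lt_top_iff_ne_top.2 h)
    refine setLIntegral_congr_fun measurableSet_Ioi fun t ht => ?_
    have ht : 0 < t := ht
    simp [abs_of_nonneg (Real.rpow_nonneg ht.le _)]
  · have h1 := Real.integral_rpow_mul_exp_neg_mul_Ioi ha hr
    have hG := Real.Gamma_pos_of_pos ha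
    have hint : IntegrableOn (fun t : ℝ => t ^ (a - 1) * Real.exp (-(r * t))) (Set.Ioi 0) :=
      .of_integral_ne_zero (by rw [h1]; positivity)
    rw [ENNReal.ofReal_rpow_of_pos hr, ← ENNReal.ofReal_mul hG.le]
    have h2 : Real.Gamma a * r ^ (-a) = (1 / r) ^ a * Real.Gamma a := by
      rw [one_div, Real.inv_rpow hr.le, Real.rpow_neg hr.le, mul_comm]
    rw [h2, ← h1, ofReal_integral_eq_lintegral_ofReal hint]
    · refine setLIntegral_congr_fun measurableSet_Ioi fun t ht => ?_
      have ht : 0 < t := ht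
      rw [← ENNReal.ofReal_mul (Real.rpow_nonneg ht.le _), mul_comm t r]
    · filter_upwards [ae_restrict_mem measurableSet_Ioi] with t ht
      have ht : 0 < t := ht
      have := Real.rpow_nonneg ht.le (a - 1)
      simp only [Pi.zero_apply]
      positivity

/-- Substituting `t ↦ r t` extracts the power of `r`. The remaining integral converges at `0`
because `1 - exp (-t) ≤ t` and `b < 1`, and at infinity because `b > 0`. -/
theorem exists_lintegral_one_sub_exp {b : ℝ} (hb : 0 < b) (hb1 : b < 1) :
    ∃ c : ℝ, 0 < c ∧ ∀ r : ℝ, 0 ≤ r →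
      ∫⁻ t in Set.Ioi (0 : ℝ), ENNReal.ofReal (t ^ (-b - 1)) *
        ENNReal.ofReal (1 - Real.exp (-(t * r))) = ENNReal.ofReal c * ENNReal.ofReal r ^ b := by
  set g : ℝ → ℝ := fun t => t ^ (-b - 1) * (1 - Real.exp (-t)) with hg
  have hg0 : ∀ t, 0 < t → 0 < g t := by
    intro t ht
    have : Real.exp (-t) < 1 := by rw [Real.exp_lt_one_iff]; linarith
    have := Real.rpow_pos_of_pos ht (-b - 1)
    exact mul_pos this (by linarith)
  have hgm : Measurable g := by fun_prop
  have hint : IntegrableOn g (Set.Ioi 0) := by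
    rw [← Set.Ioc_union_Ioi_eq_Ioi (zero_le_one (α := ℝ))]
    refine IntegrableOn.union ?_ ?_
    · have h1 : IntegrableOn (fun t : ℝ => t ^ (-b)) (Set.Ioc 0 1) :=
        (intervalIntegrable_iff_integrableOn_Ioc_of_le zero_le_one).1
          (intervalIntegral.intervalIntegrable_rpow' (by linarith))
      refine Integrable.mono' h1 hgm.aestronglyMeasurable ?_
      filter_upwards [ae_restrict_mem measurableSet_Ioc] with t ht
      have ht0 : 0 < t := ht.1
      rw [Real.norm_of_nonneg (hg0 t ht0).le, hg]
      have h2 : 1 - Real.exp (-t) ≤ t := by linarith [Real.add_one_le_exp (-t)]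
      calc t ^ (-b - 1) * (1 - Real.exp (-t)) ≤ t ^ (-b - 1) * t := by gcongr
        _ = t ^ (-b) := by
          rw [Real.rpow_sub_one ht0.ne', div_mul_cancel₀ _ ht0.ne']
    · have h1 : IntegrableOn (fun t : ℝ => t ^ (-b - 1)) (Set.Ioi 1) :=
        integrableOn_Ioi_rpow_of_lt (by linarith) one_pos
      refine Integrable.mono' h1 hgm.aestronglyMeasurable ?_
      filter_upwards [ae_restrict_mem measurableSet_Ioi] with t ht
      have ht0 : 0 < t := lt_trans one_pos ht
      rw [Real.norm_of_nonneg (hg0 t ht0).le, hg]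
      have : 1 - Real.exp (-t) ≤ 1 := by linarith [Real.exp_pos (-t)]
      exact mul_le_of_le_one_right (Real.rpow_nonneg ht0.le _) this
  have hpos : 0 < ∫ t in Set.Ioi (0 : ℝ), g t := by
    rw [setIntegral_pos_iff_support_of_nonneg_ae _ hint]
    · refine lt_of_lt_of_le ?_ (measure_mono (s := Set.Ioi 0) fun t ht => ⟨(hg0 t ht).ne', ht⟩)
      simp
    · filter_upwards [ae_restrict_mem measurableSet_Ioi] with t ht using (hg0 t ht).le
  refine ⟨_, hpos, fun r hr => ?_⟩
  rcases hr.eq_or_lt with rfl | hr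
  · simp [ENNReal.zero_rpow_of_pos hb]
  have h1 := integral_comp_mul_left_Ioi g 0 hr
  rw [mul_zero, smul_eq_mul] at h1
  have h2 : ∀ t ∈ Set.Ioi (0 : ℝ), t ^ (-b - 1) * (1 - Real.exp (-(t * r))) =
      r ^ (b + 1) * g (r * t) := by
    intro t ht
    have ht : 0 < t := ht
    rw [hg]
    simp only
    rw [Real.mul_rpow hr.le ht.le, ← mul_assoc, ← mul_assoc, ← Real.rpow_add hr, mul_comm t r]
    simp
  have h3 : ∫ t in Set.Ioi (0 : ℝ), t ^ (-b - 1) * (1 - Real.exp (-(t * r))) =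
      (∫ t in Set.Ioi (0 : ℝ), g t) * r ^ b := by
    rw [setIntegral_congr_fun measurableSet_Ioi h2, integral_const_mul, h1, Real.rpow_add_one hr.ne']
    field_simp
  have hint' : IntegrableOn (fun t : ℝ => t ^ (-b - 1) * (1 - Real.exp (-(t * r)))) (Set.Ioi 0) :=
    .of_integral_ne_zero (by rw [h3]; positivity)
  rw [ENNReal.ofReal_rpow_of_pos hr, ← ENNReal.ofReal_mul hpos.le, ← h3,
    ofReal_integral_eq_lintegral_ofReal hint']
  · refine setLIntegral_congr_fun measurableSet_Ioi fun t ht => ?_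
    have ht : 0 < t := ht
    rw [← ENNReal.ofReal_mul (Real.rpow_nonneg ht.le _)]
  · filter_upwards [ae_restrict_mem measurableSet_Ioi] with t ht
    have ht' : 0 < t := ht
    rw [h2 t ht]
    have := hg0 (r * t) (by positivity)
    simp only [Pi.zero_apply]
    positivity

end Riesz

/-! ### Strict definiteness of Riesz kernels and of positive powers -/

section StrictPositivity

theorem mutualEnergy_lintegral {X : Type*} [MeasurableSpace X] (w : ℝ → ℝ≥0∞) (hw : Measurable w)
    (g : ℝ → X × X → ℝ≥0∞) (hg : Measurable (Function.uncurry g)) (m : Measure ℝ) [SFinite m]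
    (μ ν : Measure X) [SFinite μ] [SFinite ν] :
    mutualEnergy (fun p => ∫⁻ t, w t * g t p ∂m) μ ν = ∫⁻ t, w t * mutualEnergy (g t) μ ν ∂m := by
  unfold mutualEnergy
  rw [lintegral_lintegral_swap]
  · refine lintegral_congr fun t => ?_
    exact lintegral_const_mul _ (hg.comp (by fun_prop : Measurable fun p : X × X => (t, p)))
  · refine Measurable.aemeasurable ?_
    exact (hw.comp measurable_snd).mul (hg.comp measurable_swap)

theorem edist_rpow_eq {E : Type*} [SeminormedAddCommGroup E] (x y : E) (a : ℝ) :
    edist x y ^ a = ENNReal.ofReal (‖x - y‖ ^ 2) ^ (a / 2) := by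
  rw [edist_dist, dist_eq_norm, ENNReal.ofReal_pow (norm_nonneg _), ← ENNReal.rpow_natCast,
    ← ENNReal.rpow_mul]
  congr 1
  push_cast
  ring

variable {E : Type*} [NormedAddCommGroup E] [InnerProductSpace ℝ E] [FiniteDimensional ℝ E]
  [MeasurableSpace E] [BorelSpace E]

theorem mutualEnergy_riesz {s : ℝ} (hs : 0 < s) (μ ν : Measure E) [IsProbabilityMeasure μ]
    [IsProbabilityMeasure ν] :
    ENNReal.ofReal (Real.Gamma (s / 2)) * mutualEnergy (fun p : E × E => edist p.1 p.2 ^ (-s)) μ ν =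
      ∫⁻ t in Set.Ioi (0 : ℝ), ENNReal.ofReal (t ^ (s / 2 - 1)) * mutualEnergy
        (fun p : E × E => ENNReal.ofReal (Real.exp (-(t * ‖p.1 - p.2‖ ^ 2)))) μ ν := by
  rw [← mutualEnergy_lintegral _ (by fun_prop) _ (by unfold Function.uncurry; fun_prop)]
  unfold mutualEnergy
  rw [← lintegral_const_mul _ (by fun_prop)]
  refine lintegral_congr fun p => ?_
  rw [lintegral_rpow_mul_exp (by positivity) (by positivity), edist_rpow_eq, neg_div]

theorem eq_of_mutualEnergy_riesz_le {s : ℝ} (hs : 0 < s) {μ ν : Measure E} [IsProbabilityMeasure μ]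
    [IsProbabilityMeasure ν]
    (hμ : mutualEnergy (fun p : E × E => edist p.1 p.2 ^ (-s)) μ μ ≠ ⊤)
    (hν : mutualEnergy (fun p : E × E => edist p.1 p.2 ^ (-s)) ν ν ≠ ⊤)
    (h : mutualEnergy (fun p : E × E => edist p.1 p.2 ^ (-s)) μ μ +
      mutualEnergy (fun p : E × E => edist p.1 p.2 ^ (-s)) ν ν ≤
        2 * mutualEnergy (fun p : E × E => edist p.1 p.2 ^ (-s)) μ ν) : μ = ν := by
  have hm : ∀ μ ν : Measure E, IsProbabilityMeasure μ → IsProbabilityMeasure ν →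
      Measurable fun t : ℝ => ENNReal.ofReal (t ^ (s / 2 - 1)) * mutualEnergy
        (fun p : E × E => ENNReal.ofReal (Real.exp (-(t * ‖p.1 - p.2‖ ^ 2)))) μ ν := by
    intro μ ν _ _
    refine Measurable.mul (by fun_prop) (Measurable.lintegral_prod_right' (f := fun q : ℝ × (E × E)
      => ENNReal.ofReal (Real.exp (-(q.1 * ‖q.2.1 - q.2.2‖ ^ 2)))) (by fun_prop))
  have hfin : ENNReal.ofReal (Real.Gamma (s / 2)) *
      (mutualEnergy (fun p : E × E => edist p.1 p.2 ^ (-s)) μ μ +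
      mutualEnergy (fun p : E × E => edist p.1 p.2 ^ (-s)) ν ν) ≠ ⊤ :=
    ENNReal.mul_ne_top ENNReal.ofReal_ne_top (ENNReal.add_ne_top.2 ⟨hμ, hν⟩)
  have h1 := mul_le_mul_right h (ENNReal.ofReal (Real.Gamma (s / 2)))
  have hle : ∀ t ∈ Set.Ioi (0 : ℝ), 2 * (ENNReal.ofReal (t ^ (s / 2 - 1)) * mutualEnergy
        (fun p : E × E => ENNReal.ofReal (Real.exp (-(t * ‖p.1 - p.2‖ ^ 2)))) μ ν) ≤
      ENNReal.ofReal (t ^ (s / 2 - 1)) * mutualEnergy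
        (fun p : E × E => ENNReal.ofReal (Real.exp (-(t * ‖p.1 - p.2‖ ^ 2)))) μ μ +
      ENNReal.ofReal (t ^ (s / 2 - 1)) * mutualEnergy
        (fun p : E × E => ENNReal.ofReal (Real.exp (-(t * ‖p.1 - p.2‖ ^ 2)))) ν ν := by
    intro t ht
    have ht : 0 < t := ht
    rw [mutualEnergy_gauss ht.le, mutualEnergy_gauss ht.le, mutualEnergy_gauss ht.le, ← mul_add,
      ← ENNReal.ofReal_add (gaussEnergy_nonneg _ _ _) (gaussEnergy_nonneg _ _ _), mul_left_comm]
    gcongr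
    rw [← ENNReal.ofReal_ofNat 2, ← ENNReal.ofReal_mul zero_le_two]
    exact ENNReal.ofReal_le_ofReal (two_mul_gaussEnergy_le ht.le μ ν)
  rw [mul_left_comm, mul_add, mutualEnergy_riesz hs, mutualEnergy_riesz hs, mutualEnergy_riesz hs,
    ← lintegral_add_left (hm μ μ inferInstance inferInstance),
    ← lintegral_const_mul _ (hm μ ν inferInstance inferInstance)] at h1
  rw [mul_add, mutualEnergy_riesz hs, mutualEnergy_riesz hs,
    ← lintegral_add_left (hm μ μ inferInstance inferInstance)] at hfin
  have hle' := (ae_restrict_iff' (μ := volume) measurableSet_Ioi).2 (ae_of_all _ hle)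
  -- The integrands are ordered pointwise, while their finite integrals are ordered the other way,
  -- so they agree for almost every `t`. A single `t > 0` with equality is enough.
  have hae := ae_eq_of_ae_le_of_lintegral_le hle'
    (ne_top_of_le_ne_top hfin (lintegral_mono_ae hle'))
    ((hm μ μ inferInstance inferInstance).add (hm ν ν inferInstance inferInstance)).aemeasurable h1
  have hne : (ae (volume.restrict (Set.Ioi (0 : ℝ)))).NeBot := by
    rw [ae_neBot, Ne, Measure.restrict_eq_zero]
    simp
  obtain ⟨t, ht, ht0⟩ := (hae.and (ae_restrict_mem measurableSet_Ioi)).exists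
  have ht0 : 0 < t := ht0
  beta_reduce at ht
  refine eq_of_gaussEnergy_le ht0 ?_
  rw [mutualEnergy_gauss ht0.le, mutualEnergy_gauss ht0.le, mutualEnergy_gauss ht0.le, ← mul_add,
    ← ENNReal.ofReal_add (gaussEnergy_nonneg _ _ _) (gaussEnergy_nonneg _ _ _), mul_left_comm,
    ENNReal.mul_right_inj (by simpa using Real.rpow_pos_of_pos ht0 _) (by simp),
    ← ENNReal.ofReal_ofNat 2, ← ENNReal.ofReal_mul zero_le_two] at ht
  exact (ENNReal.ofReal_le_ofReal_iff
    (mul_nonneg zero_le_two (gaussEnergy_nonneg _ _ _))).1 ht.ge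

theorem exists_mutualEnergy_rpow {a : ℝ} (ha : 0 < a) (ha2 : a < 2) :
    ∃ c : ℝ, 0 < c ∧ ∀ (μ ν : Measure E) [IsProbabilityMeasure μ] [IsProbabilityMeasure ν],
    ENNReal.ofReal c * mutualEnergy (fun p : E × E => edist p.1 p.2 ^ a) μ ν =
      ∫⁻ t in Set.Ioi (0 : ℝ), ENNReal.ofReal (t ^ (-(a / 2) - 1)) * mutualEnergy
        (fun p : E × E => ENNReal.ofReal (1 - Real.exp (-(t * ‖p.1 - p.2‖ ^ 2)))) μ ν := by
  obtain ⟨c, hc, h⟩ := exists_lintegral_one_sub_exp (b := a / 2) (by linarith) (by linarith)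
  refine ⟨c, hc, fun μ ν _ _ => ?_⟩
  rw [← mutualEnergy_lintegral _ (by fun_prop) _ (by unfold Function.uncurry; fun_prop)]
  unfold mutualEnergy
  rw [← lintegral_const_mul _ (by fun_prop)]
  refine lintegral_congr fun p => ?_
  rw [h _ (by positivity), edist_rpow_eq]

/-- Replacing the Gaussian by `1 - exp (-t r²)` reverses the polarization inequality, so the
assumption points the opposite way from the Riesz case. -/
theorem eq_of_le_mutualEnergy_rpow {a : ℝ} (ha : 0 < a) (ha2 : a < 2) {μ ν : Measure E}
    [IsProbabilityMeasure μ] [IsProbabilityMeasure ν]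
    (hfin : mutualEnergy (fun p : E × E => edist p.1 p.2 ^ a) μ μ +
      mutualEnergy (fun p : E × E => edist p.1 p.2 ^ a) ν ν ≠ ⊤)
    (h : 2 * mutualEnergy (fun p : E × E => edist p.1 p.2 ^ a) μ ν ≤
      mutualEnergy (fun p : E × E => edist p.1 p.2 ^ a) μ μ +
      mutualEnergy (fun p : E × E => edist p.1 p.2 ^ a) ν ν) : μ = ν := by
  obtain ⟨c, hc, hcE⟩ := exists_mutualEnergy_rpow (E := E) ha ha2
  have hm : ∀ μ ν : Measure E, IsProbabilityMeasure μ → IsProbabilityMeasure ν →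
      Measurable fun t : ℝ => ENNReal.ofReal (t ^ (-(a / 2) - 1)) * mutualEnergy
        (fun p : E × E => ENNReal.ofReal (1 - Real.exp (-(t * ‖p.1 - p.2‖ ^ 2)))) μ ν := by
    intro μ ν _ _
    refine Measurable.mul (by fun_prop) (Measurable.lintegral_prod_right' (f := fun q : ℝ × (E × E)
      => ENNReal.ofReal (1 - Real.exp (-(q.1 * ‖q.2.1 - q.2.2‖ ^ 2)))) (by fun_prop))
  have h1 := mul_le_mul_right h (ENNReal.ofReal c)
  have hfin' := ENNReal.mul_ne_top (a := ENNReal.ofReal c) ENNReal.ofReal_ne_top hfin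
  have hsub : ∀ (t : ℝ) (_ : 0 < t) (μ ν : Measure E) [IsProbabilityMeasure μ]
      [IsProbabilityMeasure ν], 0 ≤ 1 - gaussEnergy t μ ν := fun t ht μ ν _ _ =>
    sub_nonneg.2 (gaussEnergy_le_one ht.le μ ν)
  have hle : ∀ t ∈ Set.Ioi (0 : ℝ),
      ENNReal.ofReal (t ^ (-(a / 2) - 1)) * mutualEnergy
        (fun p : E × E => ENNReal.ofReal (1 - Real.exp (-(t * ‖p.1 - p.2‖ ^ 2)))) μ μ +
      ENNReal.ofReal (t ^ (-(a / 2) - 1)) * mutualEnergy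
        (fun p : E × E => ENNReal.ofReal (1 - Real.exp (-(t * ‖p.1 - p.2‖ ^ 2)))) ν ν ≤
      2 * (ENNReal.ofReal (t ^ (-(a / 2) - 1)) * mutualEnergy
        (fun p : E × E => ENNReal.ofReal (1 - Real.exp (-(t * ‖p.1 - p.2‖ ^ 2)))) μ ν) := by
    intro t ht
    have ht : 0 < t := ht
    rw [mutualEnergy_one_sub_gauss ht.le, mutualEnergy_one_sub_gauss ht.le,
      mutualEnergy_one_sub_gauss ht.le, ← mul_add,
      ← ENNReal.ofReal_add (hsub t ht _ _) (hsub t ht _ _), mul_left_comm]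
    gcongr
    rw [← ENNReal.ofReal_ofNat 2, ← ENNReal.ofReal_mul zero_le_two]
    exact ENNReal.ofReal_le_ofReal (by linarith [two_mul_gaussEnergy_le ht.le μ ν])
  rw [mul_left_comm, mul_add, hcE, hcE, hcE,
    ← lintegral_add_left (hm μ μ inferInstance inferInstance),
    ← lintegral_const_mul _ (hm μ ν inferInstance inferInstance)] at h1
  rw [mul_add, hcE, hcE, ← lintegral_add_left (hm μ μ inferInstance inferInstance)] at hfin'
  have hle' := (ae_restrict_iff' (μ := volume) measurableSet_Ioi).2 (ae_of_all _ hle)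
  have hae := ae_eq_of_ae_le_of_lintegral_le hle' hfin'
    ((hm μ ν inferInstance inferInstance).const_mul 2).aemeasurable h1
  have hne : (ae (volume.restrict (Set.Ioi (0 : ℝ)))).NeBot := by
    rw [ae_neBot, Ne, Measure.restrict_eq_zero]
    simp
  obtain ⟨t, ht, ht0⟩ := (hae.and (ae_restrict_mem measurableSet_Ioi)).exists
  have ht0 : 0 < t := ht0
  beta_reduce at ht
  refine eq_of_gaussEnergy_le ht0 ?_
  rw [mutualEnergy_one_sub_gauss ht0.le, mutualEnergy_one_sub_gauss ht0.le,
    mutualEnergy_one_sub_gauss ht0.le, ← mul_add,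
    ← ENNReal.ofReal_add (hsub t ht0 _ _) (hsub t ht0 _ _), mul_left_comm,
    ENNReal.mul_right_inj (by simpa using Real.rpow_pos_of_pos ht0 _) (by simp),
    ← ENNReal.ofReal_ofNat 2, ← ENNReal.ofReal_mul zero_le_two] at ht
  have := (ENNReal.ofReal_le_ofReal_iff
    (add_nonneg (hsub t ht0 μ μ) (hsub t ht0 ν ν))).1 ht.ge
  linarith

end StrictPositivity

/-! ### Lifting measures from the half-plane to sets of revolution -/

section Rotation

theorem dist_rot_sq (φ ψ : ℝ) (z w : ℂ) :
    dist (rot φ (embed z)) (rot ψ (embed w)) ^ 2 =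
      dist z w ^ 2 + 2 * (z.re * w.re) * (1 - Real.cos (φ - ψ)) := by
  rw [EuclideanSpace.dist_eq, Real.sq_sqrt (by positivity), Complex.dist_eq, Complex.sq_norm,
    Complex.normSq_apply]
  simp only [Real.dist_eq, sq_abs, Fin.sum_univ_three, rot, embed, Real.cos_sub, Complex.sub_re,
    Complex.sub_im]
  simp
  linear_combination (z.re ^ 2) * Real.sin_sq_add_cos_sq φ + (w.re ^ 2) * Real.sin_sq_add_cos_sq ψ

theorem rot_zero (p : EuclideanSpace ℝ (Fin 3)) : rot 0 p = p := by
  ext i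
  fin_cases i <;> simp [rot]

theorem edist_rot (φ ψ : ℝ) (z w : ℂ) :
    edist (rot φ (embed z)) (rot ψ (embed w)) =
      ENNReal.ofReal (√(dist z w ^ 2 + 2 * (z.re * w.re) * (1 - Real.cos (φ - ψ)))) := by
  rw [edist_dist, ← dist_rot_sq, Real.sqrt_sq dist_nonneg]

theorem edist_rot_embed (φ : ℝ) (z w : ℂ) :
    edist (rot φ (embed z)) (embed w) =
      ENNReal.ofReal (√(dist z w ^ 2 + 2 * (z.re * w.re) * (1 - Real.cos φ))) := by
  simpa [rot_zero] using edist_rot φ 0 z w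

/-- The uniform probability measure on the angles `[0, 2π)`. -/
def angleMeasure : Measure ℝ :=
  (ENNReal.ofReal (2 * Real.pi))⁻¹ • volume.restrict (Set.Ico (0 : ℝ) (2 * Real.pi))

instance : IsProbabilityMeasure angleMeasure := ⟨by
  simp only [angleMeasure, Measure.smul_apply, MeasurableSet.univ, Measure.restrict_apply,
    Set.univ_inter, Real.volume_Ico, sub_zero, smul_eq_mul]
  exact ENNReal.inv_mul_cancel (by simp [Real.pi_pos]) ENNReal.ofReal_ne_top⟩

theorem kernelS_eq (s : ℝ) (z w : ℂ) :
    kernelS s z w = ∫⁻ φ, edist (rot φ (embed z)) (embed w) ^ (-s) ∂angleMeasure := by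
  rw [kernelS, angleMeasure, lintegral_smul_measure, smul_eq_mul, ENNReal.div_eq_inv_mul]

theorem kernelS_comm (s : ℝ) (z w : ℂ) : kernelS s z w = kernelS s w z := by
  simp_rw [kernelS, edist_rot_embed, dist_comm z w, mul_comm z.re w.re]

/-- The shifted interval is another fundamental domain for the translations by multiples of `2π`. -/
theorem lintegral_angleMeasure_sub {h : ℝ → ℝ≥0∞} (hp : Function.Periodic h (2 * Real.pi))
    (φ : ℝ) : ∫⁻ ψ, h (ψ - φ) ∂angleMeasure = ∫⁻ ψ, h ψ ∂angleMeasure := by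
  have hper : ∀ (g : AddSubgroup.zmultiples (2 * Real.pi)) (x : ℝ), h (g +ᵥ x) = h x := by
    rintro ⟨g, n, rfl⟩ x
    rw [AddSubgroup.vadd_def, vadd_eq_add, add_comm]
    exact hp.zsmul n x
  rw [angleMeasure, lintegral_smul_measure, lintegral_smul_measure]
  congr 1
  rw [restrict_Ico_eq_restrict_Ioc]
  have h1 : ∫⁻ ψ in Set.Ioc (0 : ℝ) (2 * Real.pi), h (ψ - φ) =
      ∫⁻ ψ in Set.Ioc (-φ) (-φ + 2 * Real.pi), h ψ := by
    rw [← lintegral_indicator measurableSet_Ioc, ← lintegral_indicator measurableSet_Ioc,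
      ← lintegral_sub_right_eq_self (μ := volume) (Set.indicator _ h) φ]
    refine lintegral_congr fun ψ => ?_
    have : ψ ∈ Set.Ioc (0 : ℝ) (2 * Real.pi) ↔ ψ - φ ∈ Set.Ioc (-φ) (-φ + 2 * Real.pi) := by
      simp only [Set.mem_Ioc]
      constructor <;> rintro ⟨h1, h2⟩ <;> constructor <;> linarith
    by_cases hψ : ψ ∈ Set.Ioc (0 : ℝ) (2 * Real.pi)
    · rw [Set.indicator_of_mem hψ, Set.indicator_of_mem (this.1 hψ)]
    · rw [Set.indicator_of_notMem hψ, Set.indicator_of_notMem fun h => hψ (this.2 h)]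
  rw [h1]
  have h2 := IsAddFundamentalDomain.setLIntegral_eq
    (isAddFundamentalDomain_Ioc Real.two_pi_pos (-φ)) (isAddFundamentalDomain_Ioc Real.two_pi_pos 0)
    h hper
  rwa [zero_add] at h2

theorem lintegral_edist_rot (s φ : ℝ) (z w : ℂ) :
    ∫⁻ ψ, edist (rot φ (embed z)) (rot ψ (embed w)) ^ (-s) ∂angleMeasure = kernelS s z w := by
  rw [kernelS_eq]
  simp_rw [edist_rot, edist_rot_embed]
  rw [← lintegral_angleMeasure_sub (h := fun ψ =>
    ENNReal.ofReal (√(dist z w ^ 2 + 2 * (z.re * w.re) * (1 - Real.cos ψ))) ^ (-s))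
    (fun ψ => by simp only [Real.cos_add_two_pi]) φ]
  refine lintegral_congr fun ψ => ?_
  rw [← Real.cos_neg (ψ - φ), neg_sub]

theorem continuous_rot_embed : Continuous fun q : ℂ × ℝ => rot q.2 (embed q.1) := by
  unfold rot embed
  refine (PiLp.continuous_toLp 2 _).comp ?_
  refine continuous_pi fun i => ?_
  fin_cases i <;> simp <;> fun_prop

/-- The measure on the set of revolution obtained by rotating the image of `μ` under `ι`. -/
def revolveMeasure {X : Type*} [MeasurableSpace X] (ι : X → ℂ) (μ : Measure X) :
    Measure (EuclideanSpace ℝ (Fin 3)) :=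
  (μ.prod angleMeasure).map fun q => rot q.2 (embed (ι q.1))

variable {X : Type*} [MeasurableSpace X] {ι : X → ℂ}

theorem measurable_rot_embed (hι : Measurable ι) :
    Measurable fun q : X × ℝ => rot q.2 (embed (ι q.1)) :=
  Measurable.comp (g := fun q : ℂ × ℝ => rot q.2 (embed q.1)) (f := fun q : X × ℝ => (ι q.1, q.2))
    continuous_rot_embed.measurable ((hι.comp measurable_fst).prodMk measurable_snd)

theorem isProbabilityMeasure_revolveMeasure (hι : Measurable ι) (μ : Measure X)
    [IsProbabilityMeasure μ] : IsProbabilityMeasure (revolveMeasure ι μ) :=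
  Measure.isProbabilityMeasure_map (measurable_rot_embed hι).aemeasurable

/-- Distances between rotated points depend on the difference of angles only, so one angular
integral yields `kernelS` and the other is an average of a constant. -/
theorem mutualEnergy_revolveMeasure (hι : Measurable ι) (s : ℝ) (μ ν : Measure X)
    [IsProbabilityMeasure μ] [IsProbabilityMeasure ν] :
    mutualEnergy (fun p => edist p.1 p.2 ^ (-s)) (revolveMeasure ι μ) (revolveMeasure ι ν) =
      mutualEnergy (fun p => kernelS s (ι p.1) (ι p.2)) μ ν := by
  have hr := measurable_rot_embed hι
  unfold mutualEnergy revolveMeasure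
  rw [Measure.map_prod_map _ _ hr hr, lintegral_map (by fun_prop) (hr.prodMap hr)]
  obtain ⟨T, hT⟩ : ∃ T : X × ℝ → EuclideanSpace ℝ (Fin 3),
    T = fun q => rot q.2 (embed (ι q.1)) := ⟨_, rfl⟩
  have hT' : ∀ x φ, rot φ (embed (ι x)) = T (x, φ) := fun x φ => by rw [hT]
  rw [← hT] at hr
  have hF : Measurable fun p : (X × ℝ) × (X × ℝ) => edist (T p.1) (T p.2) ^ (-s) := by fun_prop
  have hinner : ∀ a : X × ℝ, ∫⁻ b, edist (T a) (T b) ^ (-s) ∂(ν.prod angleMeasure) =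
      ∫⁻ y, kernelS s (ι a.1) (ι y) ∂ν := by
    rintro ⟨x, φ⟩
    have hFa : Measurable fun b : X × ℝ => edist (T (x, φ)) (T b) ^ (-s) := by fun_prop
    rw [lintegral_prod _ hFa.aemeasurable]
    simp only [← hT', lintegral_edist_rot]
  have hk : Measurable fun p : X × X => kernelS s (ι p.1) (ι p.2) := by
    have h0 : ∀ x y, kernelS s (ι x) (ι y) =
        ∫⁻ φ, edist (T (x, φ)) (T (y, 0)) ^ (-s) ∂angleMeasure := by
      intro x y
      simp only [← hT', rot_zero, kernelS_eq]
    simp_rw [h0]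
    exact Measurable.lintegral_prod_right' (f := fun q : (X × X) × ℝ =>
      edist (T (q.1.1, q.2)) (T (q.1.2, 0)) ^ (-s)) (by fun_prop)
  simp only [Prod.map, hT']
  rw [lintegral_prod _ hF.aemeasurable]
  simp_rw [hinner]
  have hV : Measurable fun x : X × ℝ => ∫⁻ y, kernelS s (ι x.1) (ι y) ∂ν :=
    (hk.lintegral_prod_right' (ν := ν)).comp measurable_fst
  rw [lintegral_prod _ hV.aemeasurable, lintegral_prod _ hk.aemeasurable]
  simp

/-- The meridian coordinate `(√(x² + z²), y)` of a point of space. -/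
def meridian (p : EuclideanSpace ℝ (Fin 3)) : ℂ := ⟨√(p 0 ^ 2 + p 2 ^ 2), p 1⟩

theorem meridian_rot_embed (φ : ℝ) {z : ℂ} (hz : 0 ≤ z.re) : meridian (rot φ (embed z)) = z := by
  have : (Real.cos φ * z.re) ^ 2 + (Real.sin φ * z.re) ^ 2 = z.re ^ 2 := by
    linear_combination (z.re ^ 2) * Real.sin_sq_add_cos_sq φ
  apply Complex.ext
  · simp [meridian, rot, embed, this, Real.sqrt_sq hz]
  · simp [meridian, rot, embed]

theorem measurable_meridian : Measurable meridian := by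
  have : Measurable fun p : EuclideanSpace ℝ (Fin 3) =>
      Complex.equivRealProd.symm (√(p 0 ^ 2 + p 2 ^ 2), p 1) :=
    Complex.measurableEquivRealProd.symm.measurable.comp (by fun_prop)
  exact this

/-- Projecting back to the meridian half-plane undoes every rotation, because real parts are
nonnegative. -/
theorem eq_of_revolveMeasure_eq (hι : MeasurableEmbedding ι) (hre : ∀ x, 0 ≤ (ι x).re)
    {μ ν : Measure X} (h : revolveMeasure ι μ = revolveMeasure ι ν) : μ = ν := by
  have key : ∀ μ : Measure X, (revolveMeasure ι μ).map meridian = μ.map ι := by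
    intro μ
    rw [revolveMeasure, Measure.map_map measurable_meridian (measurable_rot_embed hι.measurable)]
    have : (meridian ∘ fun q : X × ℝ => rot q.2 (embed (ι q.1))) = ι ∘ Prod.fst :=
      funext fun q => meridian_rot_embed _ (hre _)
    rw [this, ← Measure.map_map hι.measurable measurable_fst, Measure.map_fst_prod]
    simp
  refine hι.map_injective ?_
  rw [← key, ← key, h]

theorem eq_of_mutualEnergy_kernelS_le (hι : MeasurableEmbedding ι) (hre : ∀ x, 0 ≤ (ι x).re)
    {s : ℝ} (hs : 0 < s) {μ ν : Measure X} [IsProbabilityMeasure μ] [IsProbabilityMeasure ν]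
    (hμ : mutualEnergy (fun p => kernelS s (ι p.1) (ι p.2)) μ μ ≠ ⊤)
    (hν : mutualEnergy (fun p => kernelS s (ι p.1) (ι p.2)) ν ν ≠ ⊤)
    (h : mutualEnergy (fun p => kernelS s (ι p.1) (ι p.2)) μ μ +
      mutualEnergy (fun p => kernelS s (ι p.1) (ι p.2)) ν ν ≤
        2 * mutualEnergy (fun p => kernelS s (ι p.1) (ι p.2)) μ ν) : μ = ν := by
  have := isProbabilityMeasure_revolveMeasure hι.measurable μ
  have := isProbabilityMeasure_revolveMeasure hι.measurable ν
  refine eq_of_revolveMeasure_eq hι hre (eq_of_mutualEnergy_riesz_le hs ?_ ?_ ?_) <;>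
  simpa only [mutualEnergy_revolveMeasure hι.measurable]

end Rotation

/-! ### Subtracting a constant from the kernel -/

section Transfer

variable {A : Set ℂ} {K : ℂ → ℂ → EReal} {k : A × A → ℝ≥0∞} {c : ℝ}

/-- This is `x - c = (x - c)⁺ - (x - c)⁻` arranged with sums only, so that it can be integrated in
`[0, ∞]`. -/
theorem toENNReal_coe_add_neg (x : ℝ≥0∞) {c : ℝ} (hc : 0 ≤ c) :
    ((x : EReal) + ((-c : ℝ) : EReal)).toENNReal + ENNReal.ofReal c =
      x + (-((x : EReal) + ((-c : ℝ) : EReal))).toENNReal := by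
  induction x with
  | top => simp
  | coe x =>
    have h1 : ((x : ℝ≥0∞) : EReal) + ((-c : ℝ) : EReal) = ((x - c : ℝ) : EReal) := by
      rw [sub_eq_add_neg, EReal.coe_add]; rfl
    rw [h1, ← EReal.coe_neg, EReal.real_coe_toENNReal, EReal.real_coe_toENNReal,
      ← ENNReal.ofReal_coe_nnreal]
    rcases le_total (x : ℝ) c with h | h
    · rw [ENNReal.ofReal_of_nonpos (by linarith), zero_add,
        ← ENNReal.ofReal_add x.coe_nonneg (by linarith)]
      congr 1; ring
    · rw [ENNReal.ofReal_of_nonpos (p := -(x - c : ℝ)) (by linarith), add_zero,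
        ← ENNReal.ofReal_add (by linarith) hc]
      congr 1; ring

/-- The negative part is at most `c`, so its integral is finite and the difference defining the
energy is never `∞ - ∞`. -/
theorem energy_eq (hk : Measurable k) (hc : 0 ≤ c)
    (hK : ∀ z w : A, K z w = (k (z, w) : EReal) + ((-c : ℝ) : EReal)) (μ : ProbabilityMeasure A) :
    energy K μ = (mutualEnergy k (μ : Measure A) (μ : Measure A) : EReal) + ((-c : ℝ) : EReal) := by
  unfold energy mutualEnergy
  have hKm : Measurable fun p : A × A => ((k p : EReal) + ((-c : ℝ) : EReal)) :=
    hk.coe_ereal_ennreal.add_const _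
  have hPm : Measurable fun p : A × A => ((k p : EReal) + ((-c : ℝ) : EReal)).toENNReal :=
    hKm.ereal_toENNReal
  have h1 : ∀ p : A × A, K p.1 p.2 = (k p : EReal) + ((-c : ℝ) : EReal) := fun p => hK p.1 p.2
  simp_rw [h1]
  have h2 : (∫⁻ p, ((k p : EReal) + ((-c : ℝ) : EReal)).toENNReal
        ∂((μ : Measure A).prod (μ : Measure A))) + ENNReal.ofReal c =
      (∫⁻ p, k p ∂((μ : Measure A).prod (μ : Measure A))) +
      ∫⁻ p, (-((k p : EReal) + ((-c : ℝ) : EReal))).toENNReal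
        ∂((μ : Measure A).prod (μ : Measure A)) := by
    rw [← lintegral_add_left hk, ← lintegral_congr fun p => toENNReal_coe_add_neg (k p) hc,
      lintegral_add_left hPm]
    simp
  have h3 : ∫⁻ p, (-((k p : EReal) + ((-c : ℝ) : EReal))).toENNReal
        ∂((μ : Measure A).prod (μ : Measure A)) ≤ ENNReal.ofReal c := by
    calc _ ≤ ∫⁻ p : A × A, ENNReal.ofReal c ∂((μ : Measure A).prod (μ : Measure A)) := by
          refine lintegral_mono fun p => ?_
          rw [← EReal.real_coe_toENNReal]
          refine EReal.toENNReal_le_toENNReal ?_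
          rw [EReal.neg_le, ← EReal.coe_neg]
          exact le_add_of_nonneg_left (EReal.coe_ennreal_nonneg _)
      _ = _ := by simp
  generalize ∫⁻ p, (-((k p : EReal) + ((-c : ℝ) : EReal))).toENNReal
        ∂((μ : Measure A).prod (μ : Measure A)) = Q at *
  generalize ∫⁻ p, ((k p : EReal) + ((-c : ℝ) : EReal)).toENNReal
        ∂((μ : Measure A).prod (μ : Measure A)) = P at *
  generalize ∫⁻ p, k p ∂((μ : Measure A).prod (μ : Measure A)) = I at *
  lift Q to ℝ≥0 using ne_top_of_le_ne_top ENNReal.ofReal_ne_top h3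
  by_cases hI : I = ⊤
  · have hP : P = ⊤ := by
      rw [hI, top_add] at h2
      by_contra h
      exact ENNReal.add_ne_top.2 ⟨h, ENNReal.ofReal_ne_top⟩ h2
    rw [hI, hP]
    rfl
  · have hP : P ≠ ⊤ := fun h => by
      rw [h, top_add] at h2
      exact ENNReal.add_ne_top.2 ⟨hI, ENNReal.coe_ne_top⟩ h2.symm
    lift P to ℝ≥0 using hP
    lift I to ℝ≥0 using hI
    have h4 : (P : ℝ) + c = I + Q := by
      have := congrArg ENNReal.toReal h2
      rwa [ENNReal.toReal_add (by simp) (by simp), ENNReal.toReal_add (by simp) (by simp),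
        ENNReal.toReal_ofReal hc] at this
    have h5 : ((P : ℝ) : EReal) - ((Q : ℝ) : EReal) = ((I : ℝ) : EReal) + ((-c : ℝ) : EReal) := by
      rw [← EReal.coe_sub, ← EReal.coe_add]
      congr 1
      linarith
    exact h5

theorem configEnergy_eq (hK : ∀ z w : A, K z w = (k (z, w) : EReal) + ((-c : ℝ) : EReal))
    {N : ℕ} (Z : Fin N → A) :
    configEnergy K Z = (tupleEnergy k Z : EReal) + ((-(c * (N * N - N)) : ℝ) : EReal) := by
  have h1 : ∀ s : Finset (Fin N × Fin N), ∑ p ∈ s, K (Z p.1) (Z p.2) =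
      ((∑ p ∈ s, k (Z p.1, Z p.2) : ℝ≥0∞) : EReal) + ((-(c * s.card) : ℝ) : EReal) := by
    intro s
    induction s using Finset.induction_on with
    | empty => simp
    | insert a s ha ih =>
      rw [Finset.sum_insert ha, Finset.sum_insert ha, Finset.card_insert_of_notMem ha, ih, hK,
        EReal.coe_ennreal_add, add_add_add_comm, ← EReal.coe_add]
      congr 2
      push_cast
      ring
  rw [configEnergy, h1, Finset.offDiag_card, tupleEnergy]
  congr 3
  rw [Nat.cast_sub (Nat.le_mul_self _)]
  simp

theorem coe_add_real_le_iff (a b : ℝ≥0∞) (r : ℝ) :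
    (a : EReal) + (r : EReal) ≤ (b : EReal) + (r : EReal) ↔ a ≤ b := by
  refine ⟨fun h => ?_, fun h => by gcongr; exact EReal.coe_ennreal_le_coe_ennreal_iff.2 h⟩
  have h1 := add_le_add_left h ((-r : ℝ) : EReal)
  rw [add_assoc, add_assoc, ← EReal.coe_add] at h1
  simpa using h1

/-- The equilibrium problem for a kernel that differs from an equilibrium kernel by a constant. -/
theorem exists_equilibrium (hA : IsCompact A) (hne : A.Nonempty) (hk : IsEquilibriumKernel k)
    (hc : 0 ≤ c) (hK : ∀ z w : A, K z w = (k (z, w) : EReal) + ((-c : ℝ) : EReal)) :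
    ∃ μ : ProbabilityMeasure A,
      IsEquilibriumMeasure K μ ∧
      (∀ ν : ProbabilityMeasure A, IsEquilibriumMeasure K ν → ν = μ) ∧
      energy K μ ≠ ⊥ ∧ energy K μ ≠ ⊤ ∧
      (∀ N : ℕ, 2 ≤ N → ∃ Z : Fin N → A, IsMinimalConfig K Z) ∧
      (∀ Z : (N : ℕ) → Fin N → A, (∀ N : ℕ, 2 ≤ N → IsMinimalConfig K (Z N)) →
        Tendsto (fun N : ℕ => countingMeasure (Z N)) atTop (𝓝 μ.toFiniteMeasure)) ∧
      Tendsto (fun N : ℕ => minEnergy K A N / ((N : EReal) ^ 2)) atTop (𝓝 (energy K μ)) := by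
  have : CompactSpace A := isCompact_iff_compactSpace.1 hA
  have : Nonempty A := hne.to_subtype
  have hm := hk.approx.measurable
  obtain ⟨μ, hμ⟩ := exists_minimal_mutualEnergy hk.approx
  have hfin : mutualEnergy k (μ : Measure A) (μ : Measure A) ≠ ⊤ := by
    obtain ⟨ρ, hρ⟩ := hk.finite
    exact ne_top_of_le_ne_top hρ (hμ ρ)
  have hE := energy_eq hm hc hK
  have hEμ : energy K μ =
      (((mutualEnergy k (μ : Measure A) (μ : Measure A)).toReal - c : ℝ) : EReal) := by
    rw [hE, sub_eq_add_neg, EReal.coe_add, EReal.coe_ennreal_toReal hfin]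
  have hmin : ∀ {N : ℕ} (Z : Fin N → A), IsMinimalConfig K Z ↔
      ∀ Z' : Fin N → A, tupleEnergy k Z ≤ tupleEnergy k Z' := by
    intro N Z
    simp only [IsMinimalConfig, configEnergy_eq hK, coe_add_real_le_iff]
  have hdirac : ∀ {N : ℕ} (_ : 2 ≤ N) (Z : Fin N → A), IsProbabilityMeasure
      ((N : ℝ≥0∞)⁻¹ • ∑ i, Measure.dirac (Z i)) := by
    intro N hN Z
    refine ⟨?_⟩
    simp only [Measure.smul_apply, Measure.finsetSum_apply, measure_univ, Finset.sum_const,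
      Finset.card_univ, Fintype.card_fin, smul_eq_mul, nsmul_eq_mul, mul_one]
    exact ENNReal.inv_mul_cancel (by simp; omega) (by simp)
  have hconv : ∀ Z : (N : ℕ) → Fin N → A, (∀ N : ℕ, 2 ≤ N → IsMinimalConfig K (Z N)) →
      Tendsto (fun N : ℕ => countingMeasure (Z N)) atTop (𝓝 μ.toFiniteMeasure) ∧
      Tendsto (fun N => tupleEnergy k (Z N) / (N : ℝ≥0∞) ^ 2) atTop
        (𝓝 (mutualEnergy k (μ : Measure A) (μ : Measure A))) := by
    intro Z hZ
    let ν : ℕ → ProbabilityMeasure A := fun N =>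
      if h : 2 ≤ N then ⟨(N : ℝ≥0∞)⁻¹ • ∑ i, Measure.dirac (Z N i), hdirac h (Z N)⟩ else μ
    have hν : ∀ N, 2 ≤ N → (ν N : Measure A) = (N : ℝ≥0∞)⁻¹ • ∑ i, Measure.dirac (Z N i) := by
      intro N hN
      have : ν N = ⟨(N : ℝ≥0∞)⁻¹ • ∑ i, Measure.dirac (Z N i), hdirac hN (Z N)⟩ := dif_pos hN
      rw [this]
      rfl
    obtain ⟨h1, h2⟩ := hk.tendsto hμ (fun N hN => (hmin _).1 (hZ N hN)) hν
    refine ⟨?_, h2⟩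
    have h3 := (ProbabilityMeasure.tendsto_nhds_iff_toFiniteMeasure_tendsto_nhds _).1 h1
    refine h3.congr' ?_
    filter_upwards [eventually_ge_atTop 2] with N hN
    refine Subtype.ext ?_
    refine (hν N hN).trans ?_
    have hN0 : (N : ℝ≥0) ≠ 0 := by simp; omega
    simp only [countingMeasure, FiniteMeasure.val_eq_toMeasure, FiniteMeasure.toMeasure_smul,
      FiniteMeasure.toMeasure_sum]
    rw [← ENNReal.coe_natCast, ← ENNReal.coe_inv hN0]
    rfl
  refine ⟨μ, ?_, ?_, ?_, ?_, ?_, fun Z hZ => (hconv Z hZ).1, ?_⟩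
  · intro ν
    rw [hE, hE, coe_add_real_le_iff]
    exact hμ ν
  · intro ν hν
    have := hν μ
    rw [hE, hE, coe_add_real_le_iff] at this
    exact (hk.eq_of_minimal hμ this).symm
  · rw [hEμ]; exact EReal.coe_ne_bot _
  · rw [hEμ]; exact EReal.coe_ne_top _
  · intro N _
    obtain ⟨Z, hZ⟩ := exists_minimal_tupleEnergy hk.approx N
    exact ⟨Z, (hmin Z).2 hZ⟩
  · choose Z hZ using fun N => exists_minimal_tupleEnergy hk.approx N
    have hZ' : ∀ N, IsMinimalConfig K (Z N) := fun N => (hmin _).2 (hZ N)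
    have hlim := (hconv Z fun N _ => hZ' N).2
    have hle : ∀ N, tupleEnergy k (Z N) ≠ ⊤ := fun N =>
      ne_top_of_le_ne_top (ENNReal.mul_ne_top (by simp) hfin) (tupleEnergy_le_of_minimal hm μ (hZ N))
    have hmE : ∀ N, minEnergy K A N =
        (((tupleEnergy k (Z N)).toReal - c * (N * N - N) : ℝ) : EReal) := by
      intro N
      have : minEnergy K A N = configEnergy K (Z N) :=
        le_antisymm (iInf_le _ _) (le_iInf (hZ' N))
      rw [this, configEnergy_eq hK, sub_eq_add_neg _ (c * _), EReal.coe_add, EReal.coe_ennreal_toReal (hle N)]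
    rw [hEμ]
    have h1 : Tendsto (fun N : ℕ => (tupleEnergy k (Z N)).toReal / (N : ℝ) ^ 2) atTop
        (𝓝 (mutualEnergy k (μ : Measure A) (μ : Measure A)).toReal) := by
      have := (ENNReal.tendsto_toReal hfin).comp hlim
      simpa [Function.comp_def, ENNReal.toReal_div] using this
    have h2 : Tendsto (fun N : ℕ => c * (1 - (N : ℝ)⁻¹)) atTop (𝓝 (c * (1 - 0))) :=
      (tendsto_const_nhds.sub tendsto_inv_atTop_nhds_zero_nat).const_mul c
    have h3 := (continuous_coe_real_ereal.tendsto _).comp (h1.sub h2)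
    rw [sub_zero, mul_one] at h3
    refine h3.congr' ?_
    filter_upwards [eventually_ge_atTop 1] with N hN
    have hN0 : (N : ℝ) ≠ 0 := by positivity
    rw [hmE, ← EReal.coe_natCast, ← EReal.coe_pow, ← EReal.coe_div, Function.comp_apply]
    congr 1
    field_simp

end Transfer

/-! ### Continuous truncations of singular kernels -/

section Approximation

theorem isSupOfContinuous_of_monotone {Y : Type*} [TopologicalSpace Y] {k : Y → ℝ≥0∞}
    (f : ℕ → Y → ℝ≥0∞) (hc : ∀ n, Continuous (f n)) (hfin : ∀ n y, f n y ≠ ⊤)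
    (hm : ∀ y, Monotone fun n => f n y) (hk : ∀ y, k y = ⨆ n, f n y) : IsSupOfContinuous k := by
  refine ⟨fun n => ⟨fun y => (f n y).toNNReal, ?_⟩, ?_, ?_⟩
  · exact ENNReal.continuousOn_toNNReal.comp_continuous (hc n) (hfin n)
  · intro m n hmn y
    exact ENNReal.toNNReal_mono (hfin n y) (hm y hmn)
  · intro y
    simp [hk, ENNReal.coe_toNNReal (hfin _ y)]

theorem IsSupOfContinuous.comp {Y Z : Type*} [TopologicalSpace Y] [TopologicalSpace Z]
    {k : Y → ℝ≥0∞} (hk : IsSupOfContinuous k) {g : Z → Y} (hg : Continuous g) :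
    IsSupOfContinuous fun z => k (g z) := by
  obtain ⟨f, hf, hkf⟩ := hk
  exact ⟨fun n => (f n).comp ⟨g, hg⟩, fun m n hmn z => hf hmn (g z), fun z => hkf (g z)⟩

theorem iSup_min_natCast (x : ℝ≥0∞) : ⨆ n : ℕ, min x (n : ℝ≥0∞) = x := by
  rw [← inf_iSup_eq, ENNReal.iSup_natCast, inf_top_eq]

theorem exists_symm_approx_edist_rpow (Y : Type*) [PseudoMetricSpace Y] (t : ℝ) :
    ∃ g : ℕ → C(Y × Y, ℝ≥0), Monotone g ∧
      (∀ p : Y × Y, edist p.1 p.2 ^ t = ⨆ n, (g n p : ℝ≥0∞)) ∧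
      ∀ n, ∀ p : Y × Y, g n p.swap = g n p := by
  have hfin : ∀ (n : ℕ) (p : Y × Y), min (edist p.1 p.2 ^ t) (n : ℝ≥0∞) ≠ ⊤ := fun n p =>
    ((min_le_right _ _).trans_lt (ENNReal.natCast_lt_top n)).ne
  refine ⟨fun n => ⟨fun p => (min (edist p.1 p.2 ^ t) (n : ℝ≥0∞)).toNNReal, ?_⟩, ?_, ?_, ?_⟩
  · refine ENNReal.continuousOn_toNNReal.comp_continuous ?_ (hfin n)
    exact (ENNReal.continuous_rpow_const.comp (continuous_fst.edist continuous_snd)).min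
      continuous_const
  · intro m n hmn p
    exact ENNReal.toNNReal_mono (hfin n p) (min_le_min_left _ (by exact_mod_cast hmn))
  · intro p
    simp only [ContinuousMap.coe_mk, ENNReal.coe_toNNReal (hfin _ p), iSup_min_natCast]
  · intro n p
    simp [edist_comm]

theorem isSupOfContinuous_edist_rpow {Y : Type*} [PseudoMetricSpace Y] (t : ℝ) :
    IsSupOfContinuous fun p : Y × Y => edist p.1 p.2 ^ t := by
  obtain ⟨g, hg, hkg, -⟩ := exists_symm_approx_edist_rpow Y t
  exact ⟨g, hg, hkg⟩

end Approximation

/-! ### Measures of finite Riesz energy from Hausdorff measure -/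

section Frostman

/-- If there are measures of bounded mass giving arbitrarily large density, at some scale, to every
point of `S`, then `S` is null for the Hausdorff measure. -/
theorem hausdorffMeasure_eq_zero_of_density {X : Type*} [MetricSpace X] [MeasurableSpace X]
    [BorelSpace X] [SecondCountableTopology X] {d : ℝ} (hd : 0 < d) (S : Set X) {C : ℝ≥0∞}
    (hC : C ≠ ⊤)
    (h : ∀ n : ℕ, ∃ M : Measure X, M Set.univ ≤ C ∧ ∀ x ∈ S, ∃ r : ℝ, 0 < r ∧ r ≤ 1 ∧
      ((n : ℝ≥0∞) + 1) * ENNReal.ofReal r ^ d ≤ M (Metric.closedBall x r)) :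
    Measure.hausdorffMeasure d S = 0 := by
  choose M hM hr using h
  choose! r hr0 hr1 hrM using hr
  have hV := fun n => Vitali.exists_disjoint_subfamily_covering_enlargement_closedBall S
    (fun x => x) (r n) 1 (fun x hx => hr1 n x hx) 5 (by norm_num)
  choose u huS hdisj hcov using hV
  have hcount : ∀ n, (u n).Countable := by
    intro n
    refine (hdisj n).countable_of_nonempty_interior fun x hx => ?_
    exact ⟨x, Metric.ball_subset_interior_closedBall
      (Metric.mem_ball_self (hr0 n x (huS n hx)))⟩
  have hcount' : ∀ n, Countable (u n) := fun n => (hcount n).to_subtype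
  have hn0 : ∀ n : ℕ, (n : ℝ≥0∞) + 1 ≠ 0 := fun n => by simp
  have hnt : ∀ n : ℕ, (n : ℝ≥0∞) + 1 ≠ ⊤ := fun n => by simp
  have hlim : Tendsto (fun n : ℕ => C / ((n : ℝ≥0∞) + 1)) atTop (𝓝 0) := by
    have h1 : Tendsto (fun n : ℕ => C / ((n : ℕ) : ℝ≥0∞)) atTop (𝓝 0) := by
      simpa using ENNReal.Tendsto.const_div (a := C) ENNReal.tendsto_nat_nhds_top (Or.inr hC)
    simpa using (tendsto_add_atTop_iff_nat 1).2 h1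
  -- The total mass bound `C` turns large density into small radii, uniformly on `S`; thus the
  -- diameters of the enlarged Vitali balls tend to zero.
  have hrle : ∀ n, ∀ x ∈ S, ENNReal.ofReal (r n x) ^ d ≤ C / ((n : ℝ≥0∞) + 1) := by
    intro n x hx
    rw [ENNReal.le_div_iff_mul_le (Or.inl (hn0 n)) (Or.inl (hnt n)), mul_comm]
    exact (hrM n x hx).trans ((measure_mono (Set.subset_univ _)).trans (hM n))
  have hsum : ∀ n, ∑' x : u n, ENNReal.ofReal (r n x) ^ d ≤ C / ((n : ℝ≥0∞) + 1) := by
    intro n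
    rw [ENNReal.le_div_iff_mul_le (Or.inl (hn0 n)) (Or.inl (hnt n)), mul_comm,
      ← ENNReal.tsum_mul_left]
    calc ∑' x : u n, ((n : ℝ≥0∞) + 1) * ENNReal.ofReal (r n x) ^ d
        ≤ ∑' x : u n, M n (Metric.closedBall x (r n x)) :=
          ENNReal.tsum_le_tsum fun x => hrM n x (huS n x.2)
      _ = M n (⋃ x ∈ u n, Metric.closedBall x (r n x)) :=
          (measure_biUnion (hcount n) (hdisj n) fun x _ => Metric.isClosed_closedBall.measurableSet).symm
      _ ≤ C := (measure_mono (Set.subset_univ _)).trans (hM n)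
  have hdiam : ∀ n (x : u n), Metric.ediam (Metric.closedBall (x : X) (5 * r n x)) ≤
      10 * ENNReal.ofReal (r n x) := by
    intro n x
    have h0 := (hr0 n x (huS n x.2)).le
    rw [← Metric.closedEBall_ofReal (by positivity)]
    refine Metric.ediam_closedEBall_le.trans (le_of_eq ?_)
    rw [ENNReal.ofReal_mul (by norm_num), ← mul_assoc]
    norm_num
  have key := Measure.hausdorffMeasure_le_liminf_tsum d S (l := atTop)
    (fun n : ℕ => 10 * (C / ((n : ℝ≥0∞) + 1)) ^ (1 / d)) ?_
    (fun n (x : u n) => Metric.closedBall (x : X) (5 * r n x)) ?_ ?_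
  · refine le_antisymm (key.trans ?_) zero_le
    have h2 : Tendsto (fun n : ℕ => (10 : ℝ≥0∞) ^ d * (C / ((n : ℝ≥0∞) + 1))) atTop (𝓝 0) := by
      simpa using ENNReal.Tendsto.const_mul hlim
        (Or.inr (ENNReal.rpow_ne_top_of_nonneg hd.le (by simp : (10 : ℝ≥0∞) ≠ ⊤)))
    rw [← h2.liminf_eq]
    refine liminf_le_liminf (Eventually.of_forall fun n => ?_)
    calc ∑' x : u n, Metric.ediam (Metric.closedBall (x : X) (5 * r n x)) ^ d
        ≤ ∑' x : u n, (10 : ℝ≥0∞) ^ d * ENNReal.ofReal (r n x) ^ d := by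
          refine ENNReal.tsum_le_tsum fun x => ?_
          rw [← ENNReal.mul_rpow_of_nonneg _ _ hd.le]
          exact ENNReal.rpow_le_rpow (hdiam n x) hd.le
      _ ≤ _ := by
          rw [ENNReal.tsum_mul_left]
          gcongr
          exact hsum n
  · have h1 := (ENNReal.continuous_rpow_const (y := 1 / d)).tendsto 0 |>.comp hlim
    rw [ENNReal.zero_rpow_of_pos (by positivity)] at h1
    simpa using ENNReal.Tendsto.const_mul (a := 10) h1 (Or.inr (by simp))
  · refine Eventually.of_forall fun n x => (hdiam n x).trans ?_
    gcongr
    rw [one_div, ENNReal.le_rpow_inv_iff hd]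
    exact hrle n x (huS n x.2)
  · refine Eventually.of_forall fun n x hx => ?_
    obtain ⟨b, hb, hsub⟩ := hcov n x hx
    exact Set.mem_iUnion.2 ⟨⟨b, hb⟩, hsub (Metric.mem_closedBall_self (hr0 n x hx).le)⟩

/-- Dyadic shells: if the distance lies in `(2^(-j-1), 2^(-j)]`, the term `j` alone suffices. The
summand `1` handles distances above `1`, and on the diagonal the series diverges. -/
theorem edist_rpow_neg_le_tsum {X : Type*} [MetricSpace X] {t : ℝ} (ht : 0 ≤ t) (x y : X) :
    edist x y ^ (-t) ≤ 1 + ∑' j : ℕ, ENNReal.ofReal (((2 : ℝ) ^ t) ^ (j + 1)) *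
      (Metric.closedBall x ((2 : ℝ)⁻¹ ^ j)).indicator 1 y := by
  have h2t : 1 ≤ (2 : ℝ) ^ t := Real.one_le_rpow one_le_two ht
  rcases eq_or_ne x y with rfl | hxy
  · have : ∑' j : ℕ, ENNReal.ofReal (((2 : ℝ) ^ t) ^ (j + 1)) *
      (Metric.closedBall x ((2 : ℝ)⁻¹ ^ j)).indicator 1 x = ⊤ := by
      rw [eq_top_iff, ← ENNReal.tsum_const_eq_top_of_ne_zero (α := ℕ) one_ne_zero]
      refine ENNReal.tsum_le_tsum fun j => ?_
      rw [Set.indicator_of_mem (Metric.mem_closedBall_self (by positivity)), Pi.one_apply, mul_one,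
        ENNReal.one_le_ofReal]
      exact one_le_pow₀ h2t
    rw [this]
    simp
  have hd : 0 < dist y x := dist_pos.2 hxy.symm
  have he : edist x y ^ (-t) = ENNReal.ofReal (dist y x ^ (-t)) := by
    rw [edist_dist, dist_comm, ENNReal.ofReal_rpow_of_pos hd]
  rw [he]
  rcases lt_or_ge 1 (dist y x) with h1 | h1
  · refine le_add_right ?_
    rw [ENNReal.ofReal_le_one]
    exact Real.rpow_le_one_of_one_le_of_nonpos h1.le (by linarith)
  · obtain ⟨j, hj1, hj2⟩ := exists_nat_pow_near_of_lt_one hd h1 (by norm_num : (0 : ℝ) < 2⁻¹)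
      (by norm_num)
    refine le_add_left (le_trans ?_ (ENNReal.le_tsum j))
    rw [Set.indicator_of_mem (Metric.mem_closedBall.2 hj2), Pi.one_apply, mul_one]
    refine ENNReal.ofReal_le_ofReal ?_
    calc dist y x ^ (-t) ≤ ((2 : ℝ)⁻¹ ^ (j + 1)) ^ (-t) :=
          Real.rpow_le_rpow_of_nonpos (by positivity) hj1.le (by linarith)
      _ = ((2 : ℝ) ^ t) ^ (j + 1) := by
          rw [inv_pow, Real.inv_rpow (by positivity), Real.rpow_neg (by positivity), inv_inv,
            ← Real.rpow_natCast, ← Real.rpow_natCast, ← Real.rpow_mul zero_le_two,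
            ← Real.rpow_mul zero_le_two, mul_comm]

/-- A large Riesz potential forces a ball of large density. -/
theorem exists_density_of_potential {t t' : ℝ} (ht : 0 ≤ t) (htt' : t < t') :
    ∃ D : ℝ≥0∞, D ≠ ⊤ ∧ ∀ {X : Type} [MetricSpace X] [MeasurableSpace X] [BorelSpace X]
      (μ : Measure X) [IsProbabilityMeasure μ] (x : X) (w : ℝ≥0∞),
      1 + w * D < ∫⁻ y, edist x y ^ (-t) ∂μ →
      ∃ r : ℝ, 0 < r ∧ r ≤ 1 ∧ w * ENNReal.ofReal r ^ t' ≤ μ (Metric.closedBall x r) := by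
  -- `D` is the dyadic bound for the potential of a measure whose balls have mass at most `r^t'`;
  -- its terms are geometric with ratio `2^(t - t') < 1`.
  refine ⟨∑' j : ℕ, ENNReal.ofReal (((2 : ℝ) ^ t) ^ (j + 1)) * ENNReal.ofReal ((2 : ℝ)⁻¹ ^ j) ^ t',
    ?_, ?_⟩
  · have h0 : ∀ j : ℕ, ENNReal.ofReal (((2 : ℝ) ^ t) ^ (j + 1)) *
        ENNReal.ofReal ((2 : ℝ)⁻¹ ^ j) ^ t' =
        ENNReal.ofReal ((2 : ℝ) ^ t * ((2 : ℝ) ^ (t - t')) ^ j) := by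
      intro j
      rw [ENNReal.ofReal_rpow_of_pos (by positivity), ← ENNReal.ofReal_mul (by positivity)]
      congr 1
      rw [inv_pow, Real.inv_rpow (by positivity), ← Real.rpow_natCast, ← Real.rpow_natCast,
        ← Real.rpow_natCast, ← Real.rpow_mul zero_le_two, ← Real.rpow_mul zero_le_two,
        ← Real.rpow_mul zero_le_two, ← Real.rpow_neg zero_le_two, ← Real.rpow_add two_pos,
        ← Real.rpow_add two_pos]
      congr 1
      push_cast
      ring
    simp_rw [h0]
    have hq : (2 : ℝ) ^ (t - t') < 1 := Real.rpow_lt_one_of_one_lt_of_neg one_lt_two (by linarith)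
    exact ((summable_geometric_of_lt_one (by positivity) hq).mul_left _).tsum_ofReal_ne_top
  · intro X _ _ _ μ _ x w hw
    by_contra! hcon
    refine hw.not_ge ?_
    calc ∫⁻ y, edist x y ^ (-t) ∂μ
        ≤ ∫⁻ y, (1 + ∑' j : ℕ, ENNReal.ofReal (((2 : ℝ) ^ t) ^ (j + 1)) *
          (Metric.closedBall x ((2 : ℝ)⁻¹ ^ j)).indicator 1 y) ∂μ :=
          lintegral_mono fun y => edist_rpow_neg_le_tsum ht x y
      _ = 1 + ∑' j : ℕ, ENNReal.ofReal (((2 : ℝ) ^ t) ^ (j + 1)) *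
          μ (Metric.closedBall x ((2 : ℝ)⁻¹ ^ j)) := by
          have hmeas : ∀ j : ℕ, Measurable ((Metric.closedBall x ((2 : ℝ)⁻¹ ^ j)).indicator
              (1 : X → ℝ≥0∞)) := fun j =>
            measurable_one.indicator Metric.isClosed_closedBall.measurableSet
          rw [lintegral_add_left measurable_const, lintegral_tsum fun j =>
            ((hmeas j).const_mul _).aemeasurable]
          simp only [lintegral_const, measure_univ, mul_one]
          congr 1
          refine tsum_congr fun j => ?_
          rw [lintegral_const_mul _ (hmeas j),
            lintegral_indicator_one Metric.isClosed_closedBall.measurableSet]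
      _ ≤ _ := by
          rw [← ENNReal.tsum_mul_left]
          refine add_le_add_right (ENNReal.tsum_le_tsum fun j => ?_) 1
          rw [mul_left_comm]
          exact mul_le_mul_right (hcon ((2 : ℝ)⁻¹ ^ j) (by positivity)
            (pow_le_one₀ (by norm_num) (by norm_num))).le _

/-- Existence of measures of finite Riesz energy. -/
theorem exists_finite_riesz_energy {A : Set ℂ} (hA : IsCompact A) (hne : A.Nonempty) {t t' : ℝ}
    (ht : 0 ≤ t) (htt' : t < t')
    (hH : Measure.hausdorffMeasure (t' + 1) (A ×ˢ Set.Icc (0 : ℝ) (2 * Real.pi)) ≠ 0) :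
    ∃ μ : ProbabilityMeasure A,
      mutualEnergy (fun p : A × A => edist p.1 p.2 ^ (-t)) (μ : Measure A) (μ : Measure A) ≠ ⊤ := by
  have : CompactSpace A := isCompact_iff_compactSpace.1 hA
  have : Nonempty A := hne.to_subtype
  by_contra! hcon
  refine hH ?_
  obtain ⟨g, hg, hkg, hgs⟩ := exists_symm_approx_edist_rpow A (-t)
  have hmin := fun n => exists_minimal_mutualEnergy (X := A) (k := fun p => (g n p : ℝ≥0∞))
    ⟨fun _ => g n, monotone_const, fun p => by simp⟩
  choose μ hμ using hmin
  -- If the minimal truncated energies stayed below `C`, a limit of the minimizers would have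
  -- untruncated energy at most `C`, against the assumption that all energies are infinite.
  have hunb : ∀ C : ℝ≥0∞, C ≠ ⊤ → ∃ n, C < mutualEnergy (fun p => (g n p : ℝ≥0∞))
      (μ n : Measure A) (μ n : Measure A) := by
    intro C hC
    by_contra! hle
    obtain ⟨ρ, -, hρ⟩ := isCompact_univ.ultrafilter_le_nhds ((hyperfilter ℕ).map μ) (by simp)
    have hρ' : Tendsto μ (hyperfilter ℕ) (𝓝 ρ) := hρ
    have h1 : mutualEnergy (fun p : A × A => edist p.1 p.2 ^ (-t)) (ρ : Measure A)
        (ρ : Measure A) ≤ C := by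
      rw [mutualEnergy_eq_iSup hg hkg]
      refine iSup_le fun m => ?_
      refine le_of_tendsto (((continuous_mutualEnergy (g m)).tendsto ρ).comp hρ') ?_
      have : ∀ᶠ n in (hyperfilter ℕ : Filter ℕ), m ≤ n :=
        Nat.hyperfilter_le_atTop (eventually_ge_atTop m)
      filter_upwards [this] with n hn
      exact (lintegral_mono fun p => ENNReal.coe_le_coe.2 (hg hn p)).trans (hle n)
    rw [hcon ρ] at h1
    exact hC (top_le_iff.1 h1)
  obtain ⟨D, hD, hdens⟩ := exists_density_of_potential ht htt'
  refine hausdorffMeasure_eq_zero_of_density (by linarith) _ (C := 9) (by simp) fun n => ?_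
  obtain ⟨m, hm⟩ := hunb (1 + ((n : ℝ≥0∞) + 1) * D)
    (ENNReal.add_ne_top.2 ⟨by simp, ENNReal.mul_ne_top (by simp) hD⟩)
  -- The interval `[-1, 8]` has length `9` and contains every ball of radius `r ≤ 1` centred in `[0,
  -- 2π]`. The Lebesgue factor contributes `2 r ≥ r`, raising the density exponent from `t'` to `t'
  -- + 1`.
  refine ⟨((μ m : Measure A).map Subtype.val).prod (volume.restrict (Set.Icc (-1) 8)), ?_, ?_⟩
  · rw [← Set.univ_prod_univ, Measure.prod_prod, Measure.map_apply measurable_subtype_coe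
      MeasurableSet.univ]
    norm_num
  · rintro ⟨x, φ⟩ ⟨hx, hφ⟩
    have h1 := mutualEnergy_le_potential (hgs m) (hμ m) ⟨x, hx⟩
    have h2 : ∫⁻ y, (g m (⟨x, hx⟩, y) : ℝ≥0∞) ∂(μ m : Measure A) ≤
        ∫⁻ y, edist (⟨x, hx⟩ : A) y ^ (-t) ∂(μ m : Measure A) := by
      refine lintegral_mono fun y => ?_
      rw [hkg (⟨x, hx⟩, y)]
      exact le_iSup (fun n => (g n (⟨x, hx⟩, y) : ℝ≥0∞)) m
    obtain ⟨r, hr0, hr1, hr⟩ := hdens (μ m : Measure A) ⟨x, hx⟩ _ (hm.trans_le (h1.trans h2))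
    refine ⟨r, hr0, hr1, ?_⟩
    rw [← closedBall_prod_same, Measure.prod_prod, Measure.map_apply measurable_subtype_coe
      Metric.isClosed_closedBall.measurableSet, ENNReal.rpow_add _ _ (by simpa) (by simp),
      ENNReal.rpow_one, ← mul_assoc]
    refine mul_le_mul' hr ?_
    have hsub : Metric.closedBall φ r ⊆ Set.Icc (-1) 8 := by
      rw [Real.closedBall_eq_Icc]
      refine Set.Icc_subset_Icc (by linarith [hφ.1]) ?_
      linarith [hφ.2, Real.pi_lt_d2]
    rw [Measure.restrict_eq_self _ hsub, Real.volume_closedBall]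
    exact ENNReal.ofReal_le_ofReal (by linarith)

/-- The rotation map is `C¹` on `ℂ × ℝ`, so it does not increase Hausdorff dimension. -/
theorem dimH_revolve_le (A : Set ℂ) :
    dimH (revolve A) ≤ dimH (A ×ˢ Set.Icc (0 : ℝ) (2 * Real.pi)) := by
  have hsm : ContDiff ℝ 1 fun q : ℂ × ℝ => rot q.2 (embed q.1) := by
    rw [contDiff_euclidean]
    have hre : ContDiff ℝ 1 fun q : ℂ × ℝ => q.1.re := Complex.reCLM.contDiff.comp contDiff_fst
    have him : ContDiff ℝ 1 fun q : ℂ × ℝ => q.1.im := Complex.imCLM.contDiff.comp contDiff_fst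
    have hcos : ContDiff ℝ 1 fun q : ℂ × ℝ => Real.cos q.2 := Real.contDiff_cos.comp contDiff_snd
    have hsin : ContDiff ℝ 1 fun q : ℂ × ℝ => Real.sin q.2 := Real.contDiff_sin.comp contDiff_snd
    intro i
    fin_cases i
    · simpa [rot, embed] using hcos.mul hre
    · simpa [rot, embed] using him
    · simpa [rot, embed] using (hsin.mul hre).neg
  refine (dimH_mono ?_).trans
    (hsm.contDiffOn.dimH_image_le convex_univ (Set.subset_univ (A ×ˢ Set.Icc (0 : ℝ) (2 * Real.pi))))
  rintro p ⟨z, hz, φ, hφ, rfl⟩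
  exact ⟨(z, φ), ⟨hz, hφ.1, hφ.2.le⟩, rfl⟩

end Frostman

/-! ### Scaling and pulling back kernels -/

section Constructions

theorem IsSupOfContinuous.const_mul {Y : Type*} [TopologicalSpace Y] {k : Y → ℝ≥0∞}
    (hk : IsSupOfContinuous k) {a : ℝ≥0∞} (ha : a ≠ ⊤) : IsSupOfContinuous fun y => a * k y := by
  obtain ⟨f, hf, hkf⟩ := hk
  lift a to ℝ≥0 using ha
  refine ⟨fun n => ⟨fun y => a * f n y, by fun_prop⟩, ?_, ?_⟩
  · intro m n hmn y
    exact mul_le_mul_right (hf hmn y) a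
  · intro y
    simp [hkf, ENNReal.mul_iSup]

theorem mutualEnergy_const_mul {X Y : Type*} [MeasurableSpace X] [MeasurableSpace Y]
    (k : X × Y → ℝ≥0∞) {a : ℝ≥0∞} (ha : a ≠ ⊤) (μ : Measure X) (ν : Measure Y) :
    mutualEnergy (fun p => a * k p) μ ν = a * mutualEnergy k μ ν :=
  lintegral_const_mul' a _ ha

theorem IsEquilibriumKernel.const_mul {X : Type*} [TopologicalSpace X] [MeasurableSpace X]
    {k : X × X → ℝ≥0∞} (hk : IsEquilibriumKernel k) {a : ℝ≥0∞} (ha0 : a ≠ 0) (ha : a ≠ ⊤) :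
    IsEquilibriumKernel fun p => a * k p where
  approx := hk.approx.const_mul ha
  symm p := by rw [hk.symm]
  finite := by
    obtain ⟨μ, hμ⟩ := hk.finite
    exact ⟨μ, by rw [mutualEnergy_const_mul _ ha]; exact ENNReal.mul_ne_top ha hμ⟩
  strictPosDef μ ν hμ hν h := by
    simp only [mutualEnergy_const_mul _ ha] at hμ hν h
    refine hk.strictPosDef μ ν (fun h => hμ ?_) (fun h => hν ?_) ?_
    · rw [h, ENNReal.mul_top ha0]
    · rw [h, ENNReal.mul_top ha0]
    · rwa [← mul_add, mul_left_comm, ENNReal.mul_le_mul_iff_right ha0 ha] at h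

theorem mutualEnergy_map {X Y : Type*} [MeasurableSpace X] [MeasurableSpace Y] {ι : X → Y}
    (hι : Measurable ι) {k : Y × Y → ℝ≥0∞} (hk : Measurable k) (μ ν : Measure X) [SFinite μ]
    [SFinite ν] :
    mutualEnergy k (μ.map ι) (ν.map ι) = mutualEnergy (fun p => k (ι p.1, ι p.2)) μ ν := by
  unfold mutualEnergy
  rw [Measure.map_prod_map _ _ hι hι, lintegral_map hk (hι.prodMap hι)]
  rfl

end Constructions

/-! ### The kernels `𝒦_s` and `𝒦_s^{(R)}` -/

section KernelS

/-- Truncate the integrand at height `n`: dominated convergence makes the integral continuous, and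
monotone convergence recovers the kernel. -/
theorem isSupOfContinuous_kernelS (s : ℝ) :
    IsSupOfContinuous fun p : ℂ × ℂ => kernelS s p.1 p.2 := by
  have hrc : Continuous fun q : (ℂ × ℂ) × ℝ =>
      edist (rot q.2 (embed q.1.1)) (embed q.1.2) ^ (-s) := by
    have h1 : Continuous fun q : (ℂ × ℂ) × ℝ => rot q.2 (embed q.1.1) :=
      Continuous.comp (g := fun q : ℂ × ℝ => rot q.2 (embed q.1))
        (f := fun q : (ℂ × ℂ) × ℝ => (q.1.1, q.2)) continuous_rot_embed (by fun_prop)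
    have h2 : Continuous fun q : (ℂ × ℂ) × ℝ => rot 0 (embed q.1.2) :=
      Continuous.comp (g := fun q : ℂ × ℝ => rot q.2 (embed q.1))
        (f := fun q : (ℂ × ℂ) × ℝ => (q.1.2, 0)) continuous_rot_embed (by fun_prop)
    simp only [rot_zero] at h2
    exact ENNReal.continuous_rpow_const.comp (h1.edist h2)
  have hφ : ∀ (p : ℂ × ℂ) (n : ℕ), Measurable fun φ =>
      min (edist (rot φ (embed p.1)) (embed p.2) ^ (-s)) (n : ℝ≥0∞) := fun p n =>
    (Continuous.comp (g := fun q : (ℂ × ℂ) × ℝ =>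
      edist (rot q.2 (embed q.1.1)) (embed q.1.2) ^ (-s)) (f := fun φ : ℝ => (p, φ)) hrc
      (by fun_prop)).measurable.min measurable_const
  refine isSupOfContinuous_of_monotone (fun n p => ∫⁻ φ, min
    (edist (rot φ (embed p.1)) (embed p.2) ^ (-s)) (n : ℝ≥0∞) ∂angleMeasure) ?_ ?_ ?_ ?_
  · intro n
    rw [continuous_iff_continuousAt]
    intro p
    refine tendsto_lintegral_filter_of_dominated_convergence (fun _ => (n : ℝ≥0∞))
      (Eventually.of_forall fun q => hφ q n)
      (Eventually.of_forall fun q => ae_of_all _ fun φ => min_le_right _ _) (by simp)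
      (ae_of_all _ fun φ => ?_)
    have h1 : Continuous fun q : ℂ × ℂ => edist (rot φ (embed q.1)) (embed q.2) ^ (-s) :=
      Continuous.comp (g := fun q : (ℂ × ℂ) × ℝ =>
        edist (rot q.2 (embed q.1.1)) (embed q.1.2) ^ (-s)) (f := fun q : ℂ × ℂ => (q, φ)) hrc
        (by fun_prop)
    exact (h1.min continuous_const).tendsto p
  · intro n p
    refine ((lintegral_mono fun φ => min_le_right _ _).trans_lt ?_).ne
    simp
  · intro p m n hmn
    exact lintegral_mono fun φ => min_le_min_left _ (by exact_mod_cast hmn)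
  · intro p
    rw [kernelS_eq, ← lintegral_iSup (hφ p) fun m n hmn φ =>
      min_le_min_left _ (by exact_mod_cast hmn)]
    simp_rw [iSup_min_natCast]

theorem lintegral_rpow_neg_ne_top {b : ℝ} (hb : b < 1) {L : ℝ} (hL : 0 < L) :
    ∫⁻ φ in Set.Ioo (0 : ℝ) L, ENNReal.ofReal φ ^ (-b) ≠ ⊤ := by
  have h1 : IntegrableOn (fun φ : ℝ => φ ^ (-b)) (Set.Ioc 0 L) :=
    (intervalIntegrable_iff_integrableOn_Ioc_of_le hL.le).1
      (intervalIntegral.intervalIntegrable_rpow' (by linarith))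
  have h2 := (h1.mono_set Set.Ioo_subset_Ioc_self).lintegral_lt_top
  rw [setLIntegral_congr_fun (g := fun φ => ENNReal.ofReal (φ ^ (-b))) measurableSet_Ioo
    fun φ hφ => ENNReal.ofReal_rpow_of_pos hφ.1]
  exact h2.ne

theorem lintegral_comp_sub_left_Ioo (F : ℝ → ℝ≥0∞) (L : ℝ) :
    ∫⁻ φ in Set.Ioo (0 : ℝ) L, F (L - φ) = ∫⁻ φ in Set.Ioo (0 : ℝ) L, F φ := by
  rw [← lintegral_indicator measurableSet_Ioo, ← lintegral_indicator measurableSet_Ioo,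
    ← lintegral_sub_left_eq_self (μ := volume) (Set.indicator _ F) L]
  refine lintegral_congr fun φ => ?_
  have : φ ∈ Set.Ioo (0 : ℝ) L ↔ L - φ ∈ Set.Ioo (0 : ℝ) L := by
    simp only [Set.mem_Ioo]
    constructor <;> rintro ⟨h1, h2⟩ <;> constructor <;> linarith
  by_cases hφ : φ ∈ Set.Ioo (0 : ℝ) L
  · rw [Set.indicator_of_mem hφ, Set.indicator_of_mem (this.1 hφ)]
  · rw [Set.indicator_of_notMem hφ, Set.indicator_of_notMem fun h => hφ (this.2 h)]

theorem two_div_pi_sq_mul_le {φ : ℝ} (h : |φ| ≤ Real.pi) :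
    2 / Real.pi ^ 2 * φ ^ 2 ≤ 1 - Real.cos φ := by
  have := Real.cos_le_one_sub_mul_cos_sq h
  linarith

/-- Away from the axis the rotated distance is at least proportional to the angle. Here `m` is the
representative of the angle in `[0, π]`, namely `φ` or `2π - φ`. -/
theorem le_edist_rot_embed {δ : ℝ} (hδ : 0 < δ) {z w : ℂ} (hz : δ ≤ z.re) (hw : δ ≤ w.re) {φ m : ℝ}
    (hm0 : 0 ≤ m) (hm : m ≤ Real.pi) (hcos : Real.cos m = Real.cos φ) :
    ENNReal.ofReal (2 * δ / Real.pi) * ENNReal.ofReal m ≤ edist (rot φ (embed z)) (embed w) := by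
  rw [edist_rot_embed, ← ENNReal.ofReal_mul (by positivity), ← hcos]
  refine ENNReal.ofReal_le_ofReal (Real.le_sqrt_of_sq_le ?_)
  have h1 := two_div_pi_sq_mul_le (abs_le.2 ⟨by linarith, hm⟩)
  have h2 : δ * δ ≤ z.re * w.re := mul_le_mul hz hw hδ.le (hδ.le.trans hz)
  calc (2 * δ / Real.pi * m) ^ 2 = 2 * (δ * δ) * (2 / Real.pi ^ 2 * m ^ 2) := by
        field_simp
    _ ≤ 2 * (z.re * w.re) * (1 - Real.cos m) :=
        mul_le_mul (by linarith) h1 (by positivity)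
          (by linarith [(by positivity : (0 : ℝ) ≤ δ * δ)])
    _ ≤ _ := le_add_of_nonneg_left (sq_nonneg _)

theorem edist_le_edist_rot_embed {z w : ℂ} (hz : 0 ≤ z.re) (hw : 0 ≤ w.re) (φ : ℝ) :
    edist z w ≤ edist (rot φ (embed z)) (embed w) := by
  rw [edist_rot_embed, edist_dist]
  refine ENNReal.ofReal_le_ofReal (Real.le_sqrt_of_sq_le ?_)
  have := Real.cos_le_one φ
  exact le_add_of_nonneg_right (mul_nonneg (by positivity) (by linarith))

/-- Split the exponent as `t + (s - t)`: the first power is controlled by `|z - w|`, the second by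
the angle, where `s - t < 1` makes it integrable. -/
theorem exists_kernelS_le {δ : ℝ} (hδ : 0 < δ) {s t : ℝ} (ht : 0 ≤ t) (hts : t ≤ s)
    (hst : s - t < 1) :
    ∃ C : ℝ≥0∞, C ≠ ⊤ ∧ ∀ z w : ℂ, δ ≤ z.re → δ ≤ w.re →
      kernelS s z w ≤ C * edist z w ^ (-t) := by
  set c := ENNReal.ofReal (2 * δ / Real.pi) with hc
  have hc0 : c ≠ 0 := by
    rw [hc, Ne, ENNReal.ofReal_eq_zero, not_le]
    positivity
  have hct : c ≠ ⊤ := ENNReal.ofReal_ne_top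
  set I := ∫⁻ φ in Set.Ioo (0 : ℝ) (2 * Real.pi), ENNReal.ofReal φ ^ (-(s - t)) with hI
  have hIt : I ≠ ⊤ := lintegral_rpow_neg_ne_top hst Real.two_pi_pos
  have hp0 : ENNReal.ofReal (2 * Real.pi) ≠ 0 := by simp [Real.pi_pos]
  have hcr : c ^ (-(s - t)) ≠ ⊤ := by simp [ENNReal.rpow_eq_top_iff, hc0, hct]
  refine ⟨c ^ (-(s - t)) * (I + I) / ENNReal.ofReal (2 * Real.pi), ?_, fun z w hz hw => ?_⟩
  · exact ENNReal.div_ne_top (ENNReal.mul_ne_top hcr (ENNReal.add_ne_top.2 ⟨hIt, hIt⟩)) hp0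
  have hpt : ∀ φ ∈ Set.Ioo (0 : ℝ) (2 * Real.pi),
      edist (rot φ (embed z)) (embed w) ^ (-s) ≤ edist z w ^ (-t) * (c ^ (-(s - t)) *
        (ENNReal.ofReal φ ^ (-(s - t)) + ENNReal.ofReal (2 * Real.pi - φ) ^ (-(s - t)))) := by
    intro φ hφ
    have h1 : edist (rot φ (embed z)) (embed w) ^ (-s) =
        edist (rot φ (embed z)) (embed w) ^ (-t) *
        edist (rot φ (embed z)) (embed w) ^ (-(s - t)) := by
      have hne := edist_ne_top (rot φ (embed z)) (embed w)
      rw [ENNReal.rpow_neg, ENNReal.rpow_neg, ENNReal.rpow_neg, ← ENNReal.mul_inv,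
        ← ENNReal.rpow_add_of_nonneg _ _ ht (by linarith), add_sub_cancel]
      · exact Or.inr (ENNReal.rpow_ne_top_of_nonneg (by linarith) hne)
      · exact Or.inl (ENNReal.rpow_ne_top_of_nonneg ht hne)
    have hanti : ∀ {x y : ℝ≥0∞} {r : ℝ}, 0 ≤ r → x ≤ y → y ^ (-r) ≤ x ^ (-r) := by
      intro x y r hr hxy
      rw [ENNReal.rpow_neg, ENNReal.rpow_neg, ENNReal.inv_le_inv]
      exact ENNReal.rpow_le_rpow hxy hr
    rw [h1]
    refine mul_le_mul' (hanti ht (edist_le_edist_rot_embed (by linarith) (by linarith) φ)) ?_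
    rcases le_total φ Real.pi with h | h
    · refine (hanti (r := s - t) (by linarith) (le_edist_rot_embed hδ hz hw hφ.1.le h rfl)).trans ?_
      rw [ENNReal.mul_rpow_of_ne_top hct ENNReal.ofReal_ne_top]
      exact mul_le_mul_right le_self_add _
    · refine (hanti (r := s - t) (by linarith) (le_edist_rot_embed hδ hz hw (m := 2 * Real.pi - φ)
        (by linarith [hφ.2]) (by linarith) (Real.cos_two_pi_sub φ))).trans ?_
      rw [ENNReal.mul_rpow_of_ne_top hct ENNReal.ofReal_ne_top]
      exact mul_le_mul_right le_add_self _
  have hm1 : Measurable fun φ : ℝ => ENNReal.ofReal φ ^ (-(s - t)) := by fun_prop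
  rw [kernelS, Measure.restrict_congr_set Ioo_ae_eq_Ico.symm,
    mul_comm _ (edist z w ^ (-t)), ← mul_div_assoc]
  refine ENNReal.div_le_div_right ?_ _
  calc _ ≤ ∫⁻ φ in Set.Ioo (0 : ℝ) (2 * Real.pi), edist z w ^ (-t) * (c ^ (-(s - t)) *
        (ENNReal.ofReal φ ^ (-(s - t)) + ENNReal.ofReal (2 * Real.pi - φ) ^ (-(s - t)))) :=
        setLIntegral_mono (by fun_prop) hpt
    _ = _ := by
        rw [lintegral_const_mul _ (by fun_prop), lintegral_const_mul _ (by fun_prop),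
          lintegral_add_left hm1, lintegral_comp_sub_left_Ioo
            (fun φ => ENNReal.ofReal φ ^ (-(s - t)))]

theorem exists_pos_le_re {A : Set ℂ} (hA : IsCompact A) (hne : A.Nonempty)
    (hAint : A ⊆ interior rightHalfPlane) : ∃ δ : ℝ, 0 < δ ∧ ∀ z ∈ A, δ ≤ z.re := by
  obtain ⟨z₀, hz₀, hmin⟩ := hA.exists_isMinOn hne Complex.continuous_re.continuousOn
  have h : interior rightHalfPlane = {z : ℂ | 0 < z.re} := Complex.interior_setOfPred_le_re 0
  exact ⟨z₀.re, by have := hAint hz₀; rwa [h] at this, fun z hz => hmin hz⟩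

theorem hausdorffMeasure_prod_ne_zero {A : Set ℂ} {d : ℝ≥0} (hd : (d : ℝ≥0∞) < dimH (revolve A)) :
    Measure.hausdorffMeasure (d : ℝ) (A ×ˢ Set.Icc (0 : ℝ) (2 * Real.pi)) ≠ 0 := by
  rw [hausdorffMeasure_of_lt_dimH (hd.trans_le (dimH_revolve_le A))]
  exact ENNReal.top_ne_zero

theorem exists_finite_riesz_energy_of_dimH {A : Set ℂ} (hA : IsCompact A) (hne : A.Nonempty)
    {s : ℝ} (hs : 0 < s) (hdim : ENNReal.ofReal s < dimH (revolve A)) :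
    ∃ t, 0 ≤ t ∧ t ≤ s ∧ s - t < 1 ∧ ∃ μ : ProbabilityMeasure A,
      mutualEnergy (fun p : A × A => edist p.1 p.2 ^ (-t)) (μ : Measure A) (μ : Measure A) ≠ ⊤ := by
  rcases lt_or_ge s 1 with h1 | h1
  · have : Nonempty A := hne.to_subtype
    refine ⟨0, le_rfl, hs.le, by linarith, diracProba (Classical.arbitrary A), ?_⟩
    simp [mutualEnergy]
  · obtain ⟨d, hd1, hd2⟩ := ENNReal.lt_iff_exists_nnreal_btwn.1 hdim
    have hsd : s < d := (ENNReal.ofReal_lt_coe_iff hs.le).1 hd1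
    -- The midpoint of `s` and `d` gives room on both sides: `s - t < 1` and `t < d - 1`. The
    -- minimum with `s` ensures `t ≤ s`.
    refine ⟨min s ((s + d) / 2 - 1), le_min hs.le (by linarith), min_le_left _ _, ?_, ?_⟩
    · rw [sub_lt_comm]
      exact lt_min (by linarith) (by linarith)
    · refine exists_finite_riesz_energy hA hne (t' := d - 1) (le_min hs.le (by linarith))
        (lt_of_le_of_lt (min_le_right _ _) (by linarith)) ?_
      rw [sub_add_cancel]
      exact hausdorffMeasure_prod_ne_zero hd2

/-- The shift by `R ≥ 0` preserves `|z - w|` and keeps points off the axis, so a finite-energy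
measure found for `A` itself still works. `R = 0` gives `𝒦_s`. -/
theorem isEquilibriumKernel_kernelS {A : Set ℂ} (hA : IsCompact A) (hne : A.Nonempty)
    (hAint : A ⊆ interior rightHalfPlane) {s : ℝ} (hs : 0 < s)
    (hdim : ENNReal.ofReal s < dimH (revolve A)) {R : ℝ} (hR : 0 ≤ R) :
    IsEquilibriumKernel fun p : A × A => kernelS s (R + p.1) (R + p.2) where
  approx := (isSupOfContinuous_kernelS s).comp
    (g := fun p : A × A => ((R : ℂ) + p.1, (R : ℂ) + p.2)) (by fun_prop)
  symm p := kernelS_comm _ _ _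
  finite := by
    obtain ⟨t, ht, hts, hst, μ, hμ⟩ := exists_finite_riesz_energy_of_dimH hA hne hs hdim
    obtain ⟨δ, hδ, hδA⟩ := exists_pos_le_re hA hne hAint
    obtain ⟨C, hC, hCk⟩ := exists_kernelS_le hδ ht hts hst
    refine ⟨μ, ne_top_of_le_ne_top (ENNReal.mul_ne_top hC hμ) ?_⟩
    rw [← mutualEnergy_const_mul _ hC]
    refine lintegral_mono fun p => ?_
    have hre : ∀ z : A, δ ≤ ((R : ℂ) + z).re := fun z => by
      rw [Complex.add_re, Complex.ofReal_re]
      linarith [hδA z z.2]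
    have := hCk _ _ (hre p.1) (hre p.2)
    rwa [edist_add_left] at this
  strictPosDef μ ν hμ hν h := by
    have hι : MeasurableEmbedding fun x : A => (R : ℂ) + x :=
      (measurableEmbedding_addLeft (R : ℂ)).comp (MeasurableEmbedding.subtype_coe hA.measurableSet)
    obtain ⟨δ, hδ, hδA⟩ := exists_pos_le_re hA hne hAint
    refine ProbabilityMeasure.toMeasure_injective (eq_of_mutualEnergy_kernelS_le hι (fun x => ?_) hs hμ hν h)
    rw [Complex.add_re, Complex.ofReal_re]
    linarith [hδA x x.2]

end KernelS

/-! ### The kernel `𝒦_s^{(∞)}` -/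

section KernelInf

theorem isEquilibriumKernel_edist_rpow_neg {A : Set ℂ} (hA : IsCompact A) (hne : A.Nonempty) {s : ℝ}
    (hs : 1 < s) (hdim : ENNReal.ofReal s < dimH (revolve A)) :
    IsEquilibriumKernel fun p : A × A => edist (p.1 : ℂ) (p.2 : ℂ) ^ (1 - s) where
  approx := isSupOfContinuous_edist_rpow (Y := A) (1 - s)
  symm p := by simp [edist_comm]
  finite := by
    obtain ⟨d, hd1, hd2⟩ := ENNReal.lt_iff_exists_nnreal_btwn.1 hdim
    have hsd : s < d := (ENNReal.ofReal_lt_coe_iff (by linarith)).1 hd1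
    have := exists_finite_riesz_energy hA hne (t := s - 1) (t' := d - 1) (by linarith)
      (by linarith) (by rw [sub_add_cancel]; exact hausdorffMeasure_prod_ne_zero hd2)
    simpa [Subtype.edist_eq] using this
  strictPosDef μ ν hμ hν h := by
    have hι := MeasurableEmbedding.subtype_coe hA.measurableSet
    refine ProbabilityMeasure.toMeasure_injective (hι.map_injective ?_)
    have hμ' : IsProbabilityMeasure ((μ : Measure A).map Subtype.val) :=
      Measure.isProbabilityMeasure_map hι.measurable.aemeasurable
    have hν' : IsProbabilityMeasure ((ν : Measure A).map Subtype.val) :=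
      Measure.isProbabilityMeasure_map hι.measurable.aemeasurable
    have hm : ∀ μ ν : ProbabilityMeasure A, mutualEnergy
        (fun p : ℂ × ℂ => edist p.1 p.2 ^ (-(s - 1))) ((μ : Measure A).map Subtype.val)
        ((ν : Measure A).map Subtype.val) =
        mutualEnergy (fun p : A × A => edist (p.1 : ℂ) (p.2 : ℂ) ^ (1 - s)) μ ν := fun μ ν => by
      rw [mutualEnergy_map hι.measurable (by fun_prop), neg_sub]
    refine eq_of_mutualEnergy_riesz_le (s := s - 1) (by linarith) ?_ ?_ ?_
    · exact (hm μ μ).trans_ne hμ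
    · exact (hm ν ν).trans_ne hν
    · exact (congrArg₂ _ (hm μ μ) (hm ν ν)).trans_le (h.trans_eq (congrArg _ (hm μ ν).symm))

/-- The constant `C` makes the kernel nonnegative; it cancels against unit masses, so strictness
comes from the reversed inequality for the power of the distance. -/
theorem isEquilibriumKernel_sub_rpow {A : Set ℂ} (hA : IsCompact A) (hne : A.Nonempty) {a b C : ℝ}
    (ha : 0 < a) (ha2 : a < 2) (hb : 0 < b) (hC : ∀ z w : A, b * dist (z : ℂ) w ^ a ≤ C) :
    IsEquilibriumKernel fun p : A × A => ENNReal.ofReal (C - b * dist (p.1 : ℂ) p.2 ^ a) where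
  approx := by
    refine ⟨fun _ => ⟨fun p => (C - b * dist (p.1 : ℂ) p.2 ^ a).toNNReal, ?_⟩, fun _ _ _ => le_rfl,
      fun p => ?_⟩
    · have : Continuous fun p : A × A => dist (p.1 : ℂ) p.2 ^ a :=
        (by fun_prop : Continuous fun p : A × A => dist (p.1 : ℂ) p.2).rpow_const
          fun _ => Or.inr ha.le
      exact continuous_real_toNNReal.comp (by fun_prop)
    · rw [iSup_const]
      rfl
  symm p := by simp [dist_comm]
  finite := by
    have : Nonempty A := hne.to_subtype
    refine ⟨diracProba (Classical.arbitrary A), ?_⟩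
    have h1 : ∀ p : A × A, ENNReal.ofReal (C - b * dist (p.1 : ℂ) p.2 ^ a) ≤ ENNReal.ofReal C :=
      fun p => ENNReal.ofReal_le_ofReal (sub_le_self _ (by positivity))
    refine ((lintegral_mono h1).trans_lt ?_).ne
    simp
  strictPosDef μ ν hμ hν h := by
    have hι := MeasurableEmbedding.subtype_coe hA.measurableSet
    refine ProbabilityMeasure.toMeasure_injective (hι.map_injective ?_)
    have hμ' : IsProbabilityMeasure ((μ : Measure A).map Subtype.val) :=
      Measure.isProbabilityMeasure_map hι.measurable.aemeasurable
    have hν' : IsProbabilityMeasure ((ν : Measure A).map Subtype.val) :=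
      Measure.isProbabilityMeasure_map hι.measurable.aemeasurable
    -- The two energies are complementary: they add up to `C`. This sum replaces subtraction in `[0,
    -- ∞]`.
    have hsum : ∀ μ ν : ProbabilityMeasure A,
        mutualEnergy (fun p : A × A => ENNReal.ofReal (C - b * dist (p.1 : ℂ) p.2 ^ a)) μ ν +
        ENNReal.ofReal b * mutualEnergy (fun p : ℂ × ℂ => edist p.1 p.2 ^ a)
          ((μ : Measure A).map Subtype.val) ((ν : Measure A).map Subtype.val) =
        ENNReal.ofReal C := by
      intro μ ν
      rw [mutualEnergy_map hι.measurable (by fun_prop),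
        ← mutualEnergy_const_mul _ ENNReal.ofReal_ne_top]
      unfold mutualEnergy
      have hmeas : Measurable fun p : A × A =>
          ENNReal.ofReal b * edist (p.1 : ℂ) (p.2 : ℂ) ^ a := by fun_prop
      rw [← lintegral_add_right _ hmeas]
      have h1 : ∀ p : A × A, ENNReal.ofReal (C - b * dist (p.1 : ℂ) p.2 ^ a) +
          ENNReal.ofReal b * edist (p.1 : ℂ) (p.2 : ℂ) ^ a = ENNReal.ofReal C := by
        intro p
        rw [edist_dist, ENNReal.ofReal_rpow_of_nonneg dist_nonneg ha.le, ← ENNReal.ofReal_mul hb.le,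
          ← ENNReal.ofReal_add (sub_nonneg.2 (hC _ _)) (by positivity)]
        congr 1
        ring
      simp_rw [h1]
      simp
    have hfin : ∀ μ ν : ProbabilityMeasure A, mutualEnergy (fun p : ℂ × ℂ => edist p.1 p.2 ^ a)
        ((μ : Measure A).map Subtype.val) ((ν : Measure A).map Subtype.val) ≠ ⊤ := by
      intro μ ν htop
      have := hsum μ ν
      rw [htop, ENNReal.mul_top (by simpa using hb), add_top] at this
      exact ENNReal.ofReal_ne_top this.symm
    refine eq_of_le_mutualEnergy_rpow ha ha2 (ENNReal.add_ne_top.2 ⟨hfin μ μ, hfin ν ν⟩) ?_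
    have h1 := hsum μ μ
    have h2 := hsum ν ν
    have h3 := hsum μ ν
    have hb0 : ENNReal.ofReal b ≠ 0 := by simpa using hb
    have hI : mutualEnergy (fun p : A × A => ENNReal.ofReal (C - b * dist (p.1 : ℂ) p.2 ^ a))
        (μ : Measure A) (ν : Measure A) ≠ ⊤ :=
      ne_top_of_le_ne_top ENNReal.ofReal_ne_top (h3 ▸ le_self_add)
    generalize mutualEnergy (fun p : A × A => ENNReal.ofReal (C - b * dist (p.1 : ℂ) p.2 ^ a))
      (μ : Measure A) (ν : Measure A) = Iμν at *
    generalize mutualEnergy (fun p : A × A => ENNReal.ofReal (C - b * dist (p.1 : ℂ) p.2 ^ a))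
      (μ : Measure A) (μ : Measure A) = Iμμ at *
    generalize mutualEnergy (fun p : A × A => ENNReal.ofReal (C - b * dist (p.1 : ℂ) p.2 ^ a))
      (ν : Measure A) (ν : Measure A) = Iνν at *
    rw [← ENNReal.mul_le_mul_iff_right hb0 ENNReal.ofReal_ne_top]
    have hI2 : 2 * Iμν ≠ ⊤ := ENNReal.mul_ne_top (by simp) hI
    rw [← ENNReal.add_le_add_iff_left hI2, mul_left_comm, ← mul_add, h3]
    calc 2 * ENNReal.ofReal C = (Iμμ + Iνν) + ENNReal.ofReal b * _ := by
          rw [two_mul]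
          nth_rewrite 1 [← h1]
          rw [← h2, add_add_add_comm, ← mul_add]
      _ ≤ _ := by gcongr

end KernelInf

/-! ### Extended-real normal forms and the case distinction over kernels -/

theorem mul_coe_sub_coe {a : ℝ} (ha : 0 < a) (x : ℝ≥0∞) (r : ℝ) :
    (a : EReal) * ((x : EReal) - (r : EReal)) =
      ((ENNReal.ofReal a * x : ℝ≥0∞) : EReal) + ((-(a * r) : ℝ) : EReal) := by
  induction x with
  | top =>
    rw [ENNReal.mul_top (by simpa using ha), EReal.coe_ennreal_top, EReal.top_sub_coe,
      EReal.coe_mul_top_of_pos ha, EReal.top_add_coe]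
  | coe x =>
    have h1 : ENNReal.ofReal a * (x : ℝ≥0∞) = ENNReal.ofReal (a * x) := by
      rw [ENNReal.ofReal_mul ha.le, ENNReal.ofReal_coe_nnreal]
    rw [h1, EReal.coe_ennreal_ofReal, max_eq_left (by positivity), ← EReal.coe_add,
      EReal.coe_nnreal_eq_coe_real, ← EReal.coe_sub, ← EReal.coe_mul]
    congr 1
    ring

theorem mul_coe_eq {a : ℝ} (ha : 0 < a) (x : ℝ≥0∞) :
    (a : EReal) * (x : EReal) =
      ((ENNReal.ofReal a * x : ℝ≥0∞) : EReal) + ((-(0 : ℝ) : ℝ) : EReal) := by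
  simpa using mul_coe_sub_coe ha x 0

end RevolutionEnergy

end

theorem proposition6p1 (A : Set ℂ) (hA : IsCompact A) (hAinf : A.Infinite)
    (hAint : A ⊆ interior RevolutionEnergy.rightHalfPlane)
    (s : ℝ) (hs : 0 < s) (hdim : ENNReal.ofReal s < dimH (RevolutionEnergy.revolve A))
    (K : ℂ → ℂ → EReal) (hK : RevolutionEnergy.IsAdmissibleKernel s K) :
    ∃ μ : ProbabilityMeasure A,
      -- `μ` is the unique equilibrium measure, and its energy is finite
      RevolutionEnergy.IsEquilibriumMeasure K μ ∧
      (∀ ν : ProbabilityMeasure A, RevolutionEnergy.IsEquilibriumMeasure K ν → ν = μ) ∧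
      RevolutionEnergy.energy K μ ≠ ⊥ ∧ RevolutionEnergy.energy K μ ≠ ⊤ ∧
      -- minimal configurations exist
      (∀ N : ℕ, 2 ≤ N → ∃ Z : Fin N → A, RevolutionEnergy.IsMinimalConfig K Z) ∧
      -- weak-star convergence of the normalized counting measures
      (∀ Z : (N : ℕ) → Fin N → A,
        (∀ N : ℕ, 2 ≤ N → RevolutionEnergy.IsMinimalConfig K (Z N)) →
        Tendsto (fun N : ℕ => RevolutionEnergy.countingMeasure (Z N)) atTop
          (𝓝 μ.toFiniteMeasure)) ∧
      -- convergence of the normalized minimal energies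
      Tendsto (fun N : ℕ => RevolutionEnergy.minEnergy K A N / ((N : EReal) ^ 2)) atTop
        (𝓝 (RevolutionEnergy.energy K μ)) := by
  have hne := hAinf.nonempty
  rcases hK with rfl | ⟨hs1, R, hR, rfl⟩ | ⟨hs1, rfl⟩
  · refine RevolutionEnergy.exists_equilibrium hA hne (c := 0)
      (RevolutionEnergy.isEquilibriumKernel_kernelS hA hne hAint hs hdim le_rfl) le_rfl fun z w => ?_
    simp
  · have hk := RevolutionEnergy.isEquilibriumKernel_kernelS hA hne hAint hs hdim hR.le
    have h2R : 0 < 2 * R := by positivity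
    have hk' := hk.const_mul (a := ENNReal.ofReal (2 * R)) (by simpa using hR)
      ENNReal.ofReal_ne_top
    rcases lt_or_gt_of_ne hs1 with h | h
    · refine RevolutionEnergy.exists_equilibrium hA hne
        (c := 2 * R * (RevolutionEnergy.circleEnergy s * R ^ (-s))) hk' ?_ fun z w => ?_
      · have : 0 ≤ RevolutionEnergy.circleEnergy s := ENNReal.toReal_nonneg
        positivity
      · rw [RevolutionEnergy.kernelR, if_pos h, RevolutionEnergy.mul_coe_sub_coe h2R]
    · refine RevolutionEnergy.exists_equilibrium hA hne hk' le_rfl fun z w => ?_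
      rw [RevolutionEnergy.kernelR, if_neg h.not_gt, RevolutionEnergy.mul_coe_eq h2R]
  · rcases lt_or_gt_of_ne hs1 with h | h
    · set b : ℝ := -(Real.Gamma ((s - 1) / 2) / (√Real.pi * Real.Gamma (s / 2))) with hb
      have hb0 : 0 < b := by
        have h1 : Real.Gamma ((s - 1) / 2 + 1) = (s - 1) / 2 * Real.Gamma ((s - 1) / 2) :=
          Real.Gamma_add_one (by linarith)
        have h2 : 0 < Real.Gamma ((s - 1) / 2 + 1) := Real.Gamma_pos_of_pos (by linarith)
        -- Here `(s - 1) / 2` lies in `(-1/2, 0)`, and the functional equation gives the sign.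
        have h3 : Real.Gamma ((s - 1) / 2) < 0 := by
          by_contra! h4
          rw [h1] at h2
          nlinarith
        have h4 : 0 < Real.Gamma (s / 2) := Real.Gamma_pos_of_pos (by linarith)
        rw [hb, neg_pos]
        exact div_neg_of_neg_of_pos h3 (by positivity)
      -- The diameter bound supplies the constant that makes the negative kernel nonnegative.
      have hD : ∀ z w : A, b * dist (z : ℂ) w ^ (1 - s) ≤ b * Metric.diam A ^ (1 - s) := by
        intro z w
        gcongr
        exact Metric.dist_le_diam_of_mem hA.isBounded z.2 w.2
      refine RevolutionEnergy.exists_equilibrium hA hne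
        (RevolutionEnergy.isEquilibriumKernel_sub_rpow hA hne (by linarith) (by linarith) hb0 hD)
        (c := b * Metric.diam A ^ (1 - s)) (by positivity) fun z w => ?_
      rw [RevolutionEnergy.kernelInf, edist_dist,
        ENNReal.ofReal_rpow_of_nonneg dist_nonneg (by linarith), EReal.coe_ennreal_ofReal,
        EReal.coe_ennreal_ofReal, max_eq_left (by positivity),
        max_eq_left (sub_nonneg.2 (hD z w)), ← EReal.coe_mul, ← EReal.coe_add]
      congr 1
      rw [hb]
      ring
    · have ha : 0 < Real.Gamma ((s - 1) / 2) / (√Real.pi * Real.Gamma (s / 2)) := by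
        have h1 : 0 < Real.Gamma ((s - 1) / 2) := Real.Gamma_pos_of_pos (by linarith)
        have h2 : 0 < Real.Gamma (s / 2) := Real.Gamma_pos_of_pos (by linarith)
        positivity
      refine RevolutionEnergy.exists_equilibrium hA hne
        ((RevolutionEnergy.isEquilibriumKernel_edist_rpow_neg hA hne h hdim).const_mul
          (a := ENNReal.ofReal (Real.Gamma ((s - 1) / 2) / (√Real.pi * Real.Gamma (s / 2))))
          (by simpa using ha) ENNReal.ofReal_ne_top) le_rfl fun z w => ?_
      rw [RevolutionEnergy.kernelInf, RevolutionEnergy.mul_coe_eq ha]
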